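/- For $k\ge 1$, a finite metric space $(X,d)$ is a $k$-HST if there is a finite rooted tree $T$ whose leaves are identified with the points of $X$, together with labels $\Delta(u)\ge 0$ of its vertices, such that $\Delta(u)=0$ if and only if $u$ is a leaf, $\Delta(u)\le \Delta(v)/k$ whenever $u$ is a child of $v$, and $d(x,y)=\Delta(\mathrm{lca}(x,y))$ for all $x,y\in X$, where $\mathrm{lca}$ is the least common ancestor in $T$. In the metrical task system (MTS) on $X$, a task is a function $\tau:X\to[0,\infty]$; an algorithm occupying $x$ serves $\tau$ by moving to some $y\in X$ (possibly $y=x$) at cost $d(x,y)+\tau(y)$, and its cost on a finite task sequence $\sigma$ is the sum of these costs. Let $\mathrm{cost}_{\mathrm{OPT}}(\sigma)$ be the minimum cost of serving $\sigma$ offline from a given initial state $x_0$. A randomized online algorithm $A$ starts at $x_0$ and chooses each state from the tasks seen so far (including the current one) and its random bits; it is $r$-competitive against an oblivious adversary if there is a constant $a$ such that $\mathrm{E}[\mathrm{cost}_A(\sigma)]\le r\cdot\mathrm{cost}_{\mathrm{OPT}}(\sigma)+a$ for every finite task sequence $\sigma$. Theorem. There are universal constants $C,c>0$ such that the following holds.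 Let $X$ be a $k$-HST on $n$ points with $k\ge 1$ and $k\ge C\log^2 n$, and let $x_0\in X$. If a randomized online algorithm for the MTS on $X$ with initial state $x_0$ is $r$-competitive against an oblivious adversary, then $r\ge c\log n$. -/

import Mathlib

open scoped ENNReal NNReal

universe u v

/-- A finite metric space `X` is a `k`-HST if it is isometric to the set of leaves of a finite
rooted tree `T` with vertex labels `Δ`. In Mathlib's `RootedTree` the root is `⊥`, `v ≤ w` says
that `v` is an ancestor of `w`, `v ⋖ w` says that `w` is a child of `v`, the leaves are the
maximal vertices, and `v ⊓ w` is the least common ancestor of `v` and `w`. -/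
def IsHST (k : ℝ) (X : Type u) [MetricSpace X] : Prop :=
  ∃ (T : RootedTree.{0}) (Δ : T → ℝ) (leaf : X ≃ {w : T // IsMax w}),
    Finite T ∧
    (∀ w, 0 ≤ Δ w) ∧
    (∀ w, Δ w = 0 ↔ IsMax w) ∧
    (∀ v w : T, v ⋖ w → Δ w ≤ Δ v / k) ∧
    ∀ x y : X, dist x y = Δ ((leaf x : T) ⊓ (leaf y : T))

/-- A task assigns to every point a cost in `[0, ∞]`. -/
abbrev MTSTask (X : Type u) : Type u := X → ℝ≥0∞

/-- Cost of serving `σ` along the states `s 0, s 1, …`: the `i`-th task (counted from `0`) is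
served by moving from `s i` to `s (i + 1)` and paying the cost of the task at `s (i + 1)`. -/
noncomputable def serviceCost {X : Type u} [MetricSpace X] (σ : List (MTSTask X)) (s : ℕ → X) :
    ℝ≥0∞ :=
  ∑ i : Fin σ.length, (edist (s i) (s (i + 1)) + σ.get i (s (i + 1)))

/-- The optimal offline cost of serving `σ` from the initial state `x₀`. -/
noncomputable def optCost {X : Type u} [MetricSpace X] (x₀ : X) (σ : List (MTSTask X)) : ℝ≥0∞ :=
  ⨅ (s : ℕ → X) (_ : s 0 = x₀), serviceCost σ s

/-- A randomized online algorithm with initial state `x₀`: for each random seed `ω`, the state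
occupied after a list of tasks is a function of that list (the tasks seen so far). -/
structure RandomizedOnlineAlgorithm (X : Type u) (x₀ : X) where
  /-- the space of random seeds -/
  Ω : Type v
  [measurableSpace : MeasurableSpace Ω]
  /-- the distribution of the random seed -/
  μ : MeasureTheory.Measure Ω
  [isProbabilityMeasure : MeasureTheory.IsProbabilityMeasure μ]
  /-- the state occupied after the tasks seen so far -/
  state : Ω → List (MTSTask X) → X
  state_nil : ∀ ω, state ω [] = x₀
  measurableSet_state : ∀ (h : List (MTSTask X)) (x : X), MeasurableSet {ω | state ω h = x}

namespace RandomizedOnlineAlgorithm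

attribute [instance] measurableSpace isProbabilityMeasure

variable {X : Type u} [MetricSpace X] {x₀ : X}

/-- The expected cost of the algorithm on a task sequence. -/
noncomputable def expectedCost (A : RandomizedOnlineAlgorithm.{u, v} X x₀)
    (σ : List (MTSTask X)) : ℝ≥0∞ :=
  ∫⁻ ω, serviceCost σ (fun i => A.state ω (σ.take i)) ∂A.μ

/-- The algorithm is `r`-competitive against an oblivious adversary. -/
def IsCompetitive (A : RandomizedOnlineAlgorithm.{u, v} X x₀) (r : ℝ≥0) : Prop :=
  ∃ c : ℝ≥0, ∀ σ : List (MTSTask X), A.expectedCost σ ≤ r * optCost x₀ σ + c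

end RandomizedOnlineAlgorithm

/-!
By induction up the tree, every vertex gets an adversary against the algorithms on the points below
it, forcing the ratio `log n / 128` for a cluster of `n` points. An adversary remembers an upper
bound on the work function and a price for every point; the expected price under the distribution of
the algorithm is a potential, in terms of which the algorithm pays at least the ratio per unit of
growth of the optimal cost.

At a vertex with label `D`, the clusters of the children lie at distance `D` from each other and,
since `k ≥ 16 log n`, their prices are small compared to `D`. They hence behave like the legs of a
star. A leg whose optimal cost exceeds that of another leg by `D` is saturated: it is evacuated and
its adversary starts afresh. The next hit goes to the leg where the algorithm exceeds the most the
probability that a star potential prescribes for it. For `m` legs of equal ratio a soft minimum of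
the costs gains `log m / 32` over the ratio of a leg; for two legs of ratios `R ≥ R'` an exponential
potential gains `exp (-4 (R - R' + 1))` over `R`. One of the two suffices to pass from the
logarithms of the cluster sizes `N₀ ≥ N₁ ≥ …` to the logarithm of their sum: either some `N_i` with
`i ≥ 1` is within a factor `(i + 1) ^ 4` of the sum, and the first `i + 1` clusters are used
(`4 / 128 = 1 / 32`), or the sum exceeds `N₀` by a factor of at most `exp (2 √(N₁ / N₀))`, and the
two largest clusters are used.

Forbidding points is done by infinite tasks, charging by tasks of size `ε` at a single point. The
algorithm is charged only where it has moved to, which costs a factor `1 + θ` as soon as `ε` is at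
most `θ` times the distance between distinct points, so that `ε → 0` gives the ratio in the limit.
-/

open Filter MeasureTheory Topology
open scoped BigOperators

/-- A recursive adversary strategy against the online algorithms on the point set `S`. In state `s`
it forbids the points of `evac s`, whereupon `s` becomes `settle s`, and then charges `ε` at one
point of `S`. The function `work s` bounds the work function from above and `level s` bounds its
minimum. The amount `∑ x ∈ S, price s x * p x`, where `p` is the distribution of the online
algorithm, is a potential in terms of which the algorithm pays at least `R` per unit of level. -/
structure Adversary {X : Type u} [MetricSpace X] (S : Finset X) (ε R K : ℝ) where
  State : Type
  gain : ℝ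
  gain_pos : 0 < gain
  evac : State → Set X
  level : State → ℝ
  work : State → X → ℝ
  price : State → X → ℝ
  fresh : ℝ → State
  settle : State → State
  level_fresh : ∀ a, level (fresh a) = a
  work_fresh : ∀ a, ∀ x ∈ S, work (fresh a) x = a
  exists_work_le : ∀ s, ∃ y ∈ S, y ∉ evac s ∧ work s y ≤ level s
  lipschitzOnWith_price : ∀ s, LipschitzOnWith 1 (price s) S
  abs_price_le : ∀ s, ∀ x ∈ S, |price s x| ≤ K
  level_settle : ∀ s, level (settle s) = level s
  price_settle : ∀ s, ∀ x ∈ S, x ∉ evac s → price (settle s) x = price s x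
  work_settle : ∀ s, ∀ x ∈ S, ∃ y ∈ S, y ∉ evac s ∧ work s y + dist y x ≤ work (settle s) x
  exists_step : ∀ s (p : X → ℝ), (∀ x ∈ S, 0 ≤ p x) → (∀ x ∈ S, x ∈ evac s → p x = 0) →
    ∃ l ∈ S, ∃ s', gain ≤ level s' - level s ∧ level s' - level s ≤ ε ∧
      R * (∑ x ∈ S, p x) * (level s' - level s) + ∑ x ∈ S, price s' x * p x
        ≤ ∑ x ∈ S, price s x * p x + ε * p l ∧
      (∀ x ∈ S, work (settle s) x ≤ work s' x) ∧ work (settle s) l + ε ≤ work s' l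

namespace Adversary

variable {X : Type u} [MetricSpace X]

/-- The adversary on a single point, which charges that point again and again. -/
def singleton (x : X) {ε : ℝ} (hε : 0 < ε) : Adversary {x} ε 0 0 where
  State := ℝ
  gain := ε
  gain_pos := hε
  evac _ := ∅
  level s := s
  work s _ := s
  price _ _ := 0
  fresh a := a
  settle s := s
  level_fresh _ := rfl
  work_fresh _ _ _ := rfl
  exists_work_le s := ⟨x, by simp, by simp, le_rfl⟩
  lipschitzOnWith_price _ := (LipschitzWith.const' 0).lipschitzOnWith
  abs_price_le _ _ _ := by simp
  level_settle _ := rfl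
  price_settle _ _ _ _ := rfl
  work_settle _ y hy := ⟨y, hy, by simp, by simp⟩
  exists_step s p hp _ := ⟨x, by simp, s + ε, by simp, by simp,
    by simpa using mul_nonneg hε.le (hp x (by simp)), by simpa using hε.le, le_rfl⟩

/-- An adversary stays valid for smaller ratios and larger price bounds. -/
def mono {S : Finset X} {ε R R' K K' : ℝ} (A : Adversary S ε R K) (hR : R' ≤ R) (hK : K ≤ K') :
    Adversary S ε R' K' where
  __ := A
  abs_price_le s x hx := (A.abs_price_le s x hx).trans hK
  exists_step s p hp h0 := by
    obtain ⟨l, hl, s', hgain, hle, hcost, hwork⟩ := A.exists_step s p hp h0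
    refine ⟨l, hl, s', hgain, hle, hcost.trans' ?_, hwork⟩
    have hmass : 0 ≤ ∑ x ∈ S, p x := Finset.sum_nonneg hp
    have hlevel : 0 ≤ A.level s' - A.level s := A.gain_pos.le.trans hgain
    gcongr

end Adversary

/-- The values of `w` differ by at most `d`. -/
def SpreadLE {ι : Type} (w : ι → ℝ) (d : ℝ) : Prop := ∀ i j, w i - w j ≤ d

/-- A strategy for the star whose legs `i` have ratios `R i`. When the legs have levels `w`, the
online algorithm is meant to be distributed as `prob w`; the function `val` is a potential with
gradient `i ↦ R i * prob w i`, up to the moving cost at rate `M`, and grows like `ρ` times the mean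
level. All this is required only for levels of spread at most `d` and increments up to `ε`. -/
structure StarPotential {ι : Type} [Fintype ι] [DecidableEq ι] (R : ι → ℝ) (ρ d M ε B : ℝ) where
  val : (ι → ℝ) → ℝ
  prob : (ι → ℝ) → ι → ℝ
  prob_pos : ∀ {w} i, SpreadLE w d → 0 < prob w i
  sum_prob : ∀ w, ∑ i, prob w i = 1
  val_update_sub_le : ∀ {w} i {h : ℝ}, SpreadLE w d → 0 ≤ h → h ≤ ε →
    SpreadLE (Function.update w i (w i + h)) d →
    val (Function.update w i (w i + h)) - val w
      ≤ R i * prob w i * h + M * (prob w i - prob (Function.update w i (w i + h)) i)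
  abs_val_sub_le : ∀ {w}, SpreadLE w d → |val w - ρ * 𝔼 i, w i| ≤ B

namespace StarPotential

variable {ι : Type} [Fintype ι] [DecidableEq ι] {R : ι → ℝ} {ρ d M ε B : ℝ}

theorem prob_le_one (P : StarPotential R ρ d M ε B) {w : ι → ℝ} (hw : SpreadLE w d) (i : ι) :
    P.prob w i ≤ 1 := by
  rw [← P.sum_prob w]
  exact Finset.single_le_sum (fun j _ => (P.prob_pos j hw).le) (Finset.mem_univ i)

end StarPotential

section Mean

variable {ι : Type} [Fintype ι]

theorem exists_max_excess [Nonempty ι] (m : ι → ℝ) {q : ι → ℝ} (hq : ∑ i, q i = 1) :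
    ∃ i, (∑ j, m j) * q i ≤ m i ∧
      ∀ j, m j - (∑ j, m j) * q j ≤ m i - (∑ j, m j) * q i := by
  obtain ⟨i, hi⟩ := Finite.exists_max fun i => m i - (∑ j, m j) * q i
  refine ⟨i, ?_, hi⟩
  have hsum : ∑ i, (m i - (∑ j, m j) * q i) = 0 := by
    rw [Finset.sum_sub_distrib, ← Finset.mul_sum, hq, mul_one, sub_self]
  obtain ⟨j, -, hj⟩ := Finset.exists_le_of_sum_le (s := Finset.univ) (f := fun _ => (0 : ℝ))
    Finset.univ_nonempty (by rw [hsum]; simp)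
  linarith [hi j]

theorem expect_update_add [DecidableEq ι] (w : ι → ℝ) (i : ι) (h : ℝ) :
    𝔼 j, Function.update w i (w i + h) j = 𝔼 j, w j + h / Fintype.card ι := by
  rw [Finset.expect_eq_sum_div_card, Finset.expect_eq_sum_div_card, Finset.card_univ, ← add_div,
    Finset.sum_update_of_mem (Finset.mem_univ i), ← Finset.sum_sdiff (Finset.subset_univ {i}),
    Finset.sum_singleton]
  ring

end Mean

section Combination

variable {ι : Type} [DecidableEq ι] {X : Type u} [MetricSpace X] {T : Finset X} {idx : X → ι}
  {R : ι → ℝ} {ε ρ K D d M B : ℝ}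

/-- A state of the adversary combined from adversaries `A i` on the parts of `T`, which lie at
mutual distance `D`: the states of these adversaries, and the part that was charged last. -/
structure CombState (A : ∀ i, Adversary {x ∈ T | idx x = i} ε (R i) K) (D : ℝ) where
  state : ∀ i, (A i).State
  target : ι
  spread : SpreadLE (fun i => (A i).level (state i)) (D + ε)

namespace CombState

variable {A : ∀ i, Adversary {x ∈ T | idx x = i} ε (R i) K}

/-- The levels of the parts. -/
def level (s : CombState A D) (i : ι) : ℝ := (A i).level (s.state i)

/-- A part is saturated when some other part is cheaper by the distance `D` between the parts, so
that the work function cannot rise there any further. -/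
def Saturated (s : CombState A D) (i : ι) : Prop := ∃ j, D ≤ s.level i - s.level j

/-- The points from which the combined adversary drives the online algorithm away: those of the
saturated parts, and those forbidden by the adversaries on the parts. -/
def evac (s : CombState A D) : Set X :=
  {x | s.Saturated (idx x) ∨ x ∈ (A (idx x)).evac (s.state (idx x))}

/-- The bound on the work function that the parts provide. -/
def work (s : CombState A D) (x : X) : ℝ := (A (idx x)).work (s.state (idx x)) x

/-- The price of a point: the price in its part, plus the potential of the star, normalised by the
mean level, minus a reward at rate `M` for following the target. -/
noncomputable def price [Fintype ι] (P : StarPotential R ρ d M ε B) (s : CombState A D) (x : X) :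
    ℝ :=
  (A (idx x)).price (s.state (idx x)) x + (P.val s.level - ρ * 𝔼 i, s.level i)
    - M * ((if idx x = s.target then 1 else 0) - P.prob s.level s.target)

/-- All parts start afresh at the same level. -/
noncomputable def fresh [Nonempty ι] (A : ∀ i, Adversary {x ∈ T | idx x = i} ε (R i) K)
    (hspread : 0 ≤ D + ε) (a : ℝ) : CombState A D where
  state i := (A i).fresh a
  target := Classical.arbitrary ι
  spread i j := by simpa only [(A _).level_fresh, sub_self] using hspread

open Classical in
/-- Saturated parts start afresh at their level, the other parts settle. -/
noncomputable def settle (s : CombState A D) : CombState A D where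
  state i := if s.Saturated i then (A i).fresh (s.level i) else (A i).settle (s.state i)
  target := s.target
  spread i j := by
    have hlevel (i : ι) : (A i).level (if s.Saturated i then (A i).fresh (s.level i)
        else (A i).settle (s.state i)) = s.level i := by
      split_ifs
      exacts [(A i).level_fresh _, (A i).level_settle _]
    simpa only [hlevel] using! s.spread i j

theorem settle_state_of_saturated {s : CombState A D} {i : ι} (hi : s.Saturated i) :
    s.settle.state i = (A i).fresh (s.level i) :=
  if_pos hi

theorem settle_state_of_not_saturated {s : CombState A D} {i : ι} (hi : ¬ s.Saturated i) :
    s.settle.state i = (A i).settle (s.state i) :=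
  if_neg hi

theorem level_settle (s : CombState A D) : s.settle.level = s.level := by
  funext i
  by_cases hi : s.Saturated i
  · rw [level, settle_state_of_saturated hi, (A i).level_fresh]
  · rw [level, settle_state_of_not_saturated hi, (A i).level_settle, level]

theorem not_saturated_of_forall_le (hD : 0 < D) {s : CombState A D} {i : ι}
    (hi : ∀ j, s.level i ≤ s.level j) : ¬ s.Saturated i := by
  rintro ⟨j, hj⟩
  linarith [hi j]

/-- Charging the unsaturated part `i` turns the state of its adversary into `t`. -/
noncomputable def advance (s : CombState A D) (i : ι) (hi : ¬ s.Saturated i) (t : (A i).State)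
    (hle : s.level i ≤ (A i).level t) (hε : (A i).level t ≤ s.level i + ε) : CombState A D where
  state := Function.update s.settle.state i t
  target := i
  spread j₁ j₂ := by
    have hlevel (j : ι) : (A j).level (Function.update s.settle.state i t j) =
        Function.update s.level i ((A i).level t) j := by
      rcases eq_or_ne j i with rfl | hj
      · simp only [Function.update_self]
      · simpa only [Function.update_of_ne hj] using! congrFun s.level_settle j
    have hspread := s.spread j₁ j₂
    simp only [Saturated, not_exists, not_le] at hi
    have hj₂ := hi j₂
    simp only [hlevel, Function.update_apply]
    change s.level j₁ - s.level j₂ ≤ D + ε at hspread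
    split_ifs with h₁ h₂ h₂ <;> subst_vars <;> linarith

theorem level_advance (s : CombState A D) (i : ι) (hi : ¬ s.Saturated i) (t : (A i).State)
    (hle : s.level i ≤ (A i).level t) (hε : (A i).level t ≤ s.level i + ε) :
    (s.advance i hi t hle hε).level =
      Function.update s.level i (s.level i + ((A i).level t - s.level i)) := by
  funext j
  rw [add_sub_cancel]
  rcases eq_or_ne j i with rfl | hj
  · simp only [level, advance, Function.update_self]
  · simpa only [level, advance, Function.update_of_ne hj] using congrFun s.level_settle j

theorem spreadLE_level (hd : D + ε ≤ d) (s : CombState A D) : SpreadLE s.level d :=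
  fun i j => (s.spread i j).trans hd

theorem notMem_evac {s : CombState A D} {x : X} :
    x ∉ s.evac ↔ ¬ s.Saturated (idx x) ∧ x ∉ (A (idx x)).evac (s.state (idx x)) :=
  not_or

theorem exists_work_le_level {s : CombState A D} {i : ι} (hi : ¬ s.Saturated i) :
    ∃ y ∈ T, idx y = i ∧ y ∉ s.evac ∧ s.work y ≤ s.level i := by
  obtain ⟨y, hy, hye, hyw⟩ := (A i).exists_work_le (s.state i)
  obtain ⟨hyT, rfl⟩ := Finset.mem_filter.1 hy
  exact ⟨y, hyT, rfl, notMem_evac.2 ⟨hi, hye⟩, hyw⟩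

theorem work_settle [Finite ι] (hD : 0 < D)
    (hdist : ∀ x ∈ T, ∀ y ∈ T, idx x ≠ idx y → dist x y = D) (s : CombState A D) {x : X}
    (hx : x ∈ T) : ∃ y ∈ T, y ∉ s.evac ∧ s.work y + dist y x ≤ s.settle.work x := by
  have hxpart : x ∈ {y ∈ T | idx y = idx x} := Finset.mem_filter.2 ⟨hx, rfl⟩
  by_cases hsat : s.Saturated (idx x)
  · have : Nonempty ι := ⟨idx x⟩
    obtain ⟨i, hmin⟩ := Finite.exists_min s.level
    have hi : ¬ s.Saturated i := not_saturated_of_forall_le hD hmin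
    obtain ⟨y, hy, rfl, hye, hyw⟩ := exists_work_le_level hi
    refine ⟨y, hy, hye, ?_⟩
    obtain ⟨j, hj⟩ := hsat
    rw [hdist y hy x hx fun h => hi (h ▸ ⟨j, hj⟩), work.eq_def s.settle,
      settle_state_of_saturated ⟨j, hj⟩, (A _).work_fresh _ x hxpart]
    linarith [hmin j]
  · obtain ⟨y, hy, hye, hyw⟩ := (A (idx x)).work_settle (s.state (idx x)) x hxpart
    obtain ⟨hyT, hidx⟩ := Finset.mem_filter.1 hy
    refine ⟨y, hyT, notMem_evac.2 ?_, ?_⟩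
    · rw [hidx]
      exact ⟨hsat, hye⟩
    · rwa [work, work, hidx, settle_state_of_not_saturated hsat]

theorem work_settle_le_work_advance {s : CombState A D} {i : ι} {hi : ¬ s.Saturated i}
    {t : (A i).State} {hle : s.level i ≤ (A i).level t} {hε : (A i).level t ≤ s.level i + ε}
    (hwork : ∀ x ∈ T, idx x = i → (A i).work ((A i).settle (s.state i)) x ≤ (A i).work t x)
    {x : X} (hx : x ∈ T) : s.settle.work x ≤ (s.advance i hi t hle hε).work x := by
  rcases eq_or_ne (idx x) i with rfl | hne
  · simpa only [work, advance, Function.update_self, settle_state_of_not_saturated hi]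
      using hwork x hx rfl
  · simp only [work, advance, Function.update_of_ne hne, le_refl]

section Price

variable [Fintype ι]

theorem price_settle (P : StarPotential R ρ d M ε B) (s : CombState A D) {x : X} (hx : x ∈ T)
    (hxe : x ∉ s.evac) : s.settle.price P x = s.price P x := by
  rw [notMem_evac] at hxe
  rw [price, price, level_settle, settle_state_of_not_saturated hxe.1,
    (A _).price_settle _ x (Finset.mem_filter.2 ⟨hx, rfl⟩) hxe.2]
  rfl

theorem abs_price_le (hM : 0 ≤ M) (hd : D + ε ≤ d) (P : StarPotential R ρ d M ε B)
    (s : CombState A D) {x : X} (hx : x ∈ T) : |s.price P x| ≤ K + B + M := by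
  have hspread := s.spreadLE_level hd
  have hpart := abs_le.1 ((A (idx x)).abs_price_le (s.state (idx x)) x (by simp [hx]))
  have hval := abs_le.1 (P.abs_val_sub_le hspread)
  have hprob := P.prob_pos s.target hspread
  have hprob' := P.prob_le_one hspread s.target
  rw [price, abs_le]
  split_ifs <;> constructor <;> nlinarith

theorem lipschitzOnWith_price (hM : 0 ≤ M) (hK : M + 2 * K ≤ D)
    (hdist : ∀ x ∈ T, ∀ y ∈ T, idx x ≠ idx y → dist x y = D) (P : StarPotential R ρ d M ε B)
    (s : CombState A D) : LipschitzOnWith 1 (s.price P) T := by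
  refine LipschitzOnWith.of_le_add fun x hx y hy => ?_
  have hxpart : x ∈ {z ∈ T | idx z = idx x} := Finset.mem_filter.2 ⟨hx, rfl⟩
  simp only [price]
  rcases eq_or_ne (idx y) (idx x) with hidx | hidx
  · have hlip := ((A (idx x)).lipschitzOnWith_price (s.state (idx x))).le_add_mul hxpart
      (Finset.mem_coe.2 (Finset.mem_filter.2 ⟨hy, hidx⟩))
    rw [NNReal.coe_one, one_mul] at hlip
    rw [hidx]
    linarith
  · have hypart : y ∈ {z ∈ T | idx z = idx y} := Finset.mem_filter.2 ⟨hy, rfl⟩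
    have hxK := abs_le.1 ((A (idx x)).abs_price_le (s.state (idx x)) x hxpart)
    have hyK := abs_le.1 ((A (idx y)).abs_price_le (s.state (idx y)) y hypart)
    rw [hdist x hx y hy hidx.symm]
    split_ifs <;> nlinarith

theorem sum_price_mul (P : StarPotential R ρ d M ε B) (s : CombState A D) (p : X → ℝ) :
    ∑ x ∈ T, s.price P x * p x =
      ∑ i, ∑ x ∈ T with idx x = i, (A i).price (s.state i) x * p x
        + (P.val s.level - ρ * 𝔼 i, s.level i) * ∑ x ∈ T, p x
        - M * (∑ x ∈ T with idx x = s.target, p x - (∑ x ∈ T, p x) * P.prob s.level s.target) := by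
  have hparts : ∑ i, ∑ x ∈ T with idx x = i, (A i).price (s.state i) x * p x =
      ∑ x ∈ T, (A (idx x)).price (s.state (idx x)) x * p x := by
    rw [← Finset.sum_fiberwise T idx]
    refine Finset.sum_congr rfl fun i _ => Finset.sum_congr rfl fun x hx => ?_
    rw [(Finset.mem_filter.1 hx).2]
  rw [hparts, Finset.sum_filter]
  simp only [price, sub_mul, add_mul, mul_sub, ite_mul, mul_ite, zero_mul, mul_one, mul_zero,
    Finset.sum_sub_distrib, Finset.sum_add_distrib, Finset.mul_sum, Finset.sum_mul]
  ring_nf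

theorem exists_not_saturated_max_excess [Nonempty ι] (hD : 0 < D) (hd : D + ε ≤ d)
    (P : StarPotential R ρ d M ε B) (s : CombState A D) {m : ι → ℝ} (hm : ∀ i, 0 ≤ m i)
    (hsat : ∀ i, s.Saturated i → m i = 0) :
    ∃ i, ¬ s.Saturated i ∧ (∑ j, m j) * P.prob s.level i ≤ m i ∧
      ∀ j, m j - (∑ j, m j) * P.prob s.level j ≤ m i - (∑ j, m j) * P.prob s.level i := by
  rcases (Finset.sum_nonneg fun i _ => hm i).eq_or_lt' with hzero | hpos
  · have hm0 (i : ι) : m i = 0 :=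
      (Finset.sum_eq_zero_iff_of_nonneg fun i _ => hm i).1 hzero i (Finset.mem_univ i)
    obtain ⟨i, hmin⟩ := Finite.exists_min s.level
    exact ⟨i, not_saturated_of_forall_le hD hmin, by simp [hm0], by simp [hm0]⟩
  · obtain ⟨i, hi, hmax⟩ := exists_max_excess m (P.sum_prob s.level)
    refine ⟨i, fun h => ?_, hi, hmax⟩
    rw [hsat i h] at hi
    exact hi.not_gt (mul_pos hpos (P.prob_pos i (s.spreadLE_level hd)))

section Advance

variable {s : CombState A D} {i : ι} {hi : ¬ s.Saturated i} {t : (A i).State}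
  {hle : s.level i ≤ (A i).level t} {hε : (A i).level t ≤ s.level i + ε} {p : X → ℝ}

theorem sum_part_price_advance (hp : ∀ x ∈ T, x ∈ s.evac → p x = 0) :
    ∑ j, ∑ x ∈ T with idx x = j, (A j).price ((s.advance i hi t hle hε).state j) x * p x =
      ∑ j, ∑ x ∈ T with idx x = j, (A j).price (s.state j) x * p x +
        (∑ x ∈ T with idx x = i, (A i).price t x * p x -
          ∑ x ∈ T with idx x = i, (A i).price (s.state i) x * p x) := by
  have hother (j : ι) (hj : j ≠ i) :
      ∑ x ∈ T with idx x = j, (A j).price ((s.advance i hi t hle hε).state j) x * p x =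
        ∑ x ∈ T with idx x = j, (A j).price (s.state j) x * p x := by
    refine Finset.sum_congr rfl fun x hx => ?_
    obtain ⟨hxT, rfl⟩ := Finset.mem_filter.1 hx
    by_cases hxe : x ∈ s.evac
    · rw [hp x hxT hxe, mul_zero, mul_zero]
    · obtain ⟨hsat, hxe⟩ := notMem_evac.1 hxe
      simp only [advance, Function.update_of_ne hj, settle_state_of_not_saturated hsat,
        (A _).price_settle _ x hx hxe]
  rw [← sub_eq_iff_eq_add', ← Finset.sum_sub_distrib, Finset.sum_eq_single i
    (fun j _ hj => sub_eq_zero.2 (hother j hj)) fun h => absurd (Finset.mem_univ i) h]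
  simp only [advance, Function.update_self]

theorem sum_price_advance_le (hM : 0 ≤ M) (hRi : 0 ≤ R i) (hd : D + ε ≤ d)
    (P : StarPotential R ρ d M ε B) {l : X} (hp : ∀ x ∈ T, 0 ≤ p x)
    (hpe : ∀ x ∈ T, x ∈ s.evac → p x = 0)
    (hexcess : (∑ x ∈ T, p x) * P.prob s.level i ≤ ∑ x ∈ T with idx x = i, p x)
    (hmax : ∑ x ∈ T with idx x = s.target, p x - (∑ x ∈ T, p x) * P.prob s.level s.target ≤
      ∑ x ∈ T with idx x = i, p x - (∑ x ∈ T, p x) * P.prob s.level i)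
    (hcost : R i * (∑ x ∈ T with idx x = i, p x) * ((A i).level t - s.level i) +
        ∑ x ∈ T with idx x = i, (A i).price t x * p x ≤
      ∑ x ∈ T with idx x = i, (A i).price (s.state i) x * p x + ε * p l) :
    ρ * (∑ x ∈ T, p x) * (((A i).level t - s.level i) / Fintype.card ι) +
        ∑ x ∈ T, (s.advance i hi t hle hε).price P x * p x ≤
      ∑ x ∈ T, s.price P x * p x + ε * p l := by
  have hval := P.val_update_sub_le i (s.spreadLE_level hd) (sub_nonneg.2 hle) (by linarith)
    (level_advance s i hi t hle hε ▸ spreadLE_level hd _)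
  have htarget : (s.advance i hi t hle hε).target = i := rfl
  rw [sum_price_mul, sum_price_mul, sum_part_price_advance hpe, level_advance, expect_update_add,
    htarget]
  set h := (A i).level t - s.level i
  set m := ∑ x ∈ T, p x
  have hm : 0 ≤ m := Finset.sum_nonneg hp
  have hh : 0 ≤ h := sub_nonneg.2 hle
  have hval' := mul_le_mul_of_nonneg_left hval hm
  have hmove := mul_le_mul_of_nonneg_left hmax hM
  have hpay := mul_le_mul_of_nonneg_left hexcess (mul_nonneg hRi hh)
  linear_combination hval' + hmove + hpay + hcost

end Advance

theorem exists_step [Nonempty ι] (hD : 0 < D) (hM : 0 ≤ M) (hR : ∀ i, 0 ≤ R i) (hd : D + ε ≤ d)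
    (P : StarPotential R ρ d M ε B) (s : CombState A D) {p : X → ℝ} (hp : ∀ x ∈ T, 0 ≤ p x)
    (hpe : ∀ x ∈ T, x ∈ s.evac → p x = 0) :
    ∃ l ∈ T, ∃ (s' : CombState A D) (i : ι),
      (A i).gain / Fintype.card ι ≤ 𝔼 j, s'.level j - 𝔼 j, s.level j ∧
      𝔼 j, s'.level j - 𝔼 j, s.level j ≤ ε ∧
      ρ * (∑ x ∈ T, p x) * (𝔼 j, s'.level j - 𝔼 j, s.level j) + ∑ x ∈ T, s'.price P x * p x
        ≤ ∑ x ∈ T, s.price P x * p x + ε * p l ∧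
      (∀ x ∈ T, s.settle.work x ≤ s'.work x) ∧ s.settle.work l + ε ≤ s'.work l := by
  obtain ⟨i, hi, hexcess, hmax⟩ := s.exists_not_saturated_max_excess hD hd P
    (m := fun i => ∑ x ∈ T with idx x = i, p x)
    (fun i => Finset.sum_nonneg fun x hx => hp x (Finset.mem_filter.1 hx).1)
    fun i hsat => Finset.sum_eq_zero fun x hx => hpe x (Finset.mem_filter.1 hx).1
      (.inl ((Finset.mem_filter.1 hx).2 ▸ hsat))
  rw [Finset.sum_fiberwise] at hexcess hmax
  obtain ⟨l, hl, t, hgain, hle, hcost, hwork, hworkl⟩ := (A i).exists_step (s.state i) p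
    (fun x hx => hp x (Finset.mem_filter.1 hx).1) fun x hx hxe => by
      obtain ⟨hxT, rfl⟩ := Finset.mem_filter.1 hx
      exact hpe x hxT (.inr hxe)
  obtain ⟨hlT, rfl⟩ := Finset.mem_filter.1 hl
  change _ ≤ _ - s.level _ at hgain
  change _ - s.level _ ≤ _ at hle
  have hrise := (A (idx l)).gain_pos.le.trans hgain
  have hcard : (1 : ℝ) ≤ Fintype.card ι := by exact_mod_cast Fintype.card_pos (α := ι)
  let s' := s.advance (idx l) hi t (sub_nonneg.1 hrise) (sub_le_iff_le_add'.1 hle)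
  have hmean : 𝔼 j, s'.level j - 𝔼 j, s.level j =
      ((A (idx l)).level t - s.level (idx l)) / Fintype.card ι := by
    rw [level_advance, expect_update_add, add_sub_cancel_left]
  refine ⟨l, hlT, s', idx l, ?_, ?_, ?_, fun x hx => ?_, ?_⟩
  · rw [hmean]
    gcongr
  · rw [hmean]
    exact (div_le_self hrise hcard).trans hle
  · rw [hmean]
    exact sum_price_advance_le hM (hR _) hd P hp hpe hexcess (hmax s.target) hcost
  · exact work_settle_le_work_advance (fun x hx hxi => hwork x (by simp [hx, hxi])) hx
  · simpa only [s', work, advance, Function.update_self, settle_state_of_not_saturated hi]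
      using hworkl

end Price

end CombState

/-- The adversary combined from adversaries on parts at mutual distance `D` according to a
potential of the star. -/
noncomputable def StarPotential.combine [Fintype ι] [Nonempty ι] (P : StarPotential R ρ d M ε B)
    (A : ∀ i, Adversary {x ∈ T | idx x = i} ε (R i) K) (hD : 0 < D) (hε : 0 ≤ ε) (hM : 0 ≤ M)
    (hK : M + 2 * K ≤ D) (hR : ∀ i, 0 ≤ R i) (hd : D + ε ≤ d)
    (hdist : ∀ x ∈ T, ∀ y ∈ T, idx x ≠ idx y → dist x y = D) :
    Adversary T ε ρ (K + B + M) where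
  State := CombState A D
  gain := (Finset.univ.inf' Finset.univ_nonempty fun i => (A i).gain) / Fintype.card ι
  gain_pos := div_pos ((Finset.lt_inf'_iff _).2 fun i _ => (A i).gain_pos)
    (by exact_mod_cast Fintype.card_pos)
  evac := CombState.evac
  level s := 𝔼 i, s.level i
  work := CombState.work
  price := CombState.price P
  fresh := CombState.fresh A (by positivity)
  settle := CombState.settle
  level_fresh a := by simp only [CombState.level, CombState.fresh, (A _).level_fresh,
    Fintype.expect_const]
  work_fresh a x hx := (A (idx x)).work_fresh a x (by simp [hx])
  exists_work_le s := by
    obtain ⟨i, hmin⟩ := Finite.exists_min s.level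
    obtain ⟨y, hy, -, hye, hyw⟩ :=
      CombState.exists_work_le_level (CombState.not_saturated_of_forall_le hD hmin)
    exact ⟨y, hy, hye, hyw.trans (Finset.le_expect Finset.univ_nonempty fun j _ => hmin j)⟩
  lipschitzOnWith_price := CombState.lipschitzOnWith_price hM hK hdist P
  abs_price_le s _ := s.abs_price_le hM hd P
  level_settle s := by rw [s.level_settle]
  price_settle s _ := s.price_settle P
  work_settle s _ := s.work_settle hD hdist
  exists_step s p hp hpe := by
    obtain ⟨l, hl, s', i, hgain, hrest⟩ := s.exists_step hD hM hR hd P hp hpe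
    refine ⟨l, hl, s', hgain.trans' ?_, hrest⟩
    gcongr
    exact Finset.inf'_le _ (Finset.mem_univ i)

end Combination

section SoftMin

variable {ι : Type} [Fintype ι] {β : ℝ} {w : ι → ℝ}

/-- The soft minimum of `w` at inverse temperature `β`, normalised so that a constant function has
its value as soft minimum. -/
noncomputable def softMin (β : ℝ) (w : ι → ℝ) : ℝ := -Real.log (𝔼 i, Real.exp (-β * w i)) / β

/-- The gradient of the soft minimum: the probabilities proportional to `exp (-β * w i)`. -/
noncomputable def gibbs (β : ℝ) (w : ι → ℝ) (i : ι) : ℝ :=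
  Real.exp (β * (softMin β w - w i)) / Fintype.card ι

theorem gibbs_mul_exp_softMin (β : ℝ) (w : ι → ℝ) (i : ι) :
    gibbs β w i * Real.exp (-β * softMin β w) = Real.exp (-β * w i) / Fintype.card ι := by
  rw [gibbs, div_mul_eq_mul_div, ← Real.exp_add]
  ring_nf

variable [Nonempty ι]

theorem exp_neg_mul_softMin (hβ : 0 < β) (w : ι → ℝ) :
    Real.exp (-β * softMin β w) = 𝔼 i, Real.exp (-β * w i) := by
  rw [softMin, neg_mul, mul_div_cancel₀ _ hβ.ne', neg_neg, Real.exp_log]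
  exact Finset.expect_pos (fun i _ => Real.exp_pos _) Finset.univ_nonempty

theorem softMin_le (hβ : 0 < β) {b : ℝ} (hw : ∀ i, w i ≤ b) : softMin β w ≤ b := by
  have hexp : Real.exp (-β * b) ≤ Real.exp (-β * softMin β w) := by
    rw [exp_neg_mul_softMin hβ]
    refine Finset.le_expect Finset.univ_nonempty fun i _ => Real.exp_le_exp.2 ?_
    nlinarith [hw i]
  nlinarith [Real.exp_le_exp.1 hexp]

theorem le_softMin (hβ : 0 < β) {a : ℝ} (hw : ∀ i, a ≤ w i) : a ≤ softMin β w := by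
  have hexp : Real.exp (-β * softMin β w) ≤ Real.exp (-β * a) := by
    rw [exp_neg_mul_softMin hβ]
    refine Finset.expect_le Finset.univ_nonempty fun i _ => Real.exp_le_exp.2 ?_
    nlinarith [hw i]
  nlinarith [Real.exp_le_exp.1 hexp]

theorem gibbs_pos (β : ℝ) (w : ι → ℝ) (i : ι) : 0 < gibbs β w i :=
  div_pos (Real.exp_pos _) (by exact_mod_cast Fintype.card_pos)

theorem sum_gibbs (hβ : 0 < β) (w : ι → ℝ) : ∑ i, gibbs β w i = 1 := by
  rw [← mul_left_inj' (Real.exp_ne_zero (-β * softMin β w)), Finset.sum_mul, one_mul]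
  simp only [gibbs_mul_exp_softMin]
  rw [exp_neg_mul_softMin hβ, Finset.expect_eq_sum_div_card, Finset.sum_div, Finset.card_univ]

theorem gibbs_le_two_thirds (hβ : 0 < β) (hcard : 2 ≤ Fintype.card ι) {d : ℝ}
    (hd : Real.exp (β * d) ≤ Fintype.card ι) (hw : SpreadLE w d) (i : ι) :
    gibbs β w i ≤ 2 / 3 := by
  classical
  have hn : (2 : ℝ) ≤ Fintype.card ι := by exact_mod_cast hcard
  have hq := gibbs_pos β w i
  have hother (j : ι) : gibbs β w i ≤ Fintype.card ι * gibbs β w j := by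
    calc gibbs β w i ≤ Real.exp (β * d) * gibbs β w j := by
          rw [gibbs, gibbs, ← mul_div_assoc, ← Real.exp_add]
          gcongr
          nlinarith [hw j i]
      _ ≤ Fintype.card ι * gibbs β w j := by gcongr; exact (gibbs_pos β w j).le
  have hsum : (Fintype.card ι - 1) * gibbs β w i ≤ Fintype.card ι * (1 - gibbs β w i) := by
    calc (Fintype.card ι - 1) * gibbs β w i = ∑ _j ∈ Finset.univ.erase i, gibbs β w i := by
          rw [Finset.sum_const, Finset.card_erase_of_mem (Finset.mem_univ i), Finset.card_univ,
            nsmul_eq_mul, Nat.cast_pred Fintype.card_pos]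
      _ ≤ ∑ j ∈ Finset.univ.erase i, Fintype.card ι * gibbs β w j :=
          Finset.sum_le_sum fun j _ => hother j
      _ = Fintype.card ι * (1 - gibbs β w i) := by
          rw [← Finset.mul_sum, Finset.sum_erase_eq_sub (Finset.mem_univ i), sum_gibbs hβ]
  nlinarith

variable [DecidableEq ι]

theorem exp_softMin_update (hβ : 0 < β) (w : ι → ℝ) (i : ι) (h : ℝ) :
    Real.exp (-β * (softMin β (Function.update w i (w i + h)) - softMin β w)) =
      1 - gibbs β w i * (1 - Real.exp (-β * h)) := by
  have hupdate : (fun j => Real.exp (-β * Function.update w i (w i + h) j)) =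
      Function.update (fun j => Real.exp (-β * w j)) i
        (Real.exp (-β * w i) + Real.exp (-β * w i) * (Real.exp (-β * h) - 1)) := by
    rw [mul_sub, ← Real.exp_add, ← mul_add, mul_one, add_sub_cancel]
    exact Function.comp_update (fun a => Real.exp (-β * a)) w i _
  rw [mul_sub, Real.exp_sub, div_eq_iff (Real.exp_ne_zero _), exp_neg_mul_softMin hβ, hupdate,
    expect_update_add, ← exp_neg_mul_softMin hβ, mul_div_right_comm, ← gibbs_mul_exp_softMin]
  ring

theorem softMin_update_sub_le (hβ : 0 < β) (w : ι → ℝ) (i : ι) (h : ℝ) :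
    softMin β (Function.update w i (w i + h)) - softMin β w ≤
      gibbs β w i * (1 - Real.exp (-β * h)) / (1 - gibbs β w i * (1 - Real.exp (-β * h))) / β := by
  have hexp := exp_softMin_update hβ w i h
  set s := softMin β (Function.update w i (w i + h)) - softMin β w
  rw [← hexp, ← sub_eq_of_eq_add' (eq_sub_iff_add_eq.1 hexp).symm, le_div_iff₀ hβ, sub_div,
    div_self (Real.exp_ne_zero _), neg_mul, Real.exp_neg, one_div, inv_inv]
  linarith [Real.add_one_le_exp (β * s)]

theorem gibbs_update (hβ : 0 < β) (w : ι → ℝ) (i : ι) (h : ℝ) :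
    gibbs β (Function.update w i (w i + h)) i =
      gibbs β w i * Real.exp (-β * h) / (1 - gibbs β w i * (1 - Real.exp (-β * h))) := by
  rw [← exp_softMin_update hβ, gibbs, gibbs, Function.update_self, div_mul_eq_mul_div,
    div_right_comm, ← Real.exp_add, ← Real.exp_sub]
  ring_nf

theorem mul_softMin_update_sub_le (hβ : 0 < β) (i : ι) {r a d M h : ℝ} (hr : 0 ≤ r) (ha : 0 ≤ a)
    (hβa : 32 * a ≤ β * d) (hM : d ≤ 4 * M) (hh : 0 ≤ h) (hrh : 32 * (r * h) ≤ d)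
    (hq : gibbs β w i ≤ 2 / 3) :
    (r + a) * (softMin β (Function.update w i (w i + h)) - softMin β w) ≤
      r * gibbs β w i * h + M * (gibbs β w i - gibbs β (Function.update w i (w i + h)) i) := by
  have hle := softMin_update_sub_le hβ w i h
  rw [gibbs_update hβ]
  have hq0 := gibbs_pos β w i
  set q := gibbs β w i
  have ht0 : 0 ≤ 1 - Real.exp (-β * h) := by
    rw [sub_nonneg, Real.exp_le_one_iff]
    nlinarith
  have ht1 : 1 - Real.exp (-β * h) ≤ 1 := by linarith [Real.exp_pos (-β * h)]
  have hth : 1 - Real.exp (-β * h) ≤ h * β := by linarith [Real.add_one_le_exp (-β * h)]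
  have hexp : Real.exp (-β * h) = 1 - (1 - Real.exp (-β * h)) := (sub_sub_cancel _ _).symm
  set t := 1 - Real.exp (-β * h)
  have hd : 0 ≤ d := (by positivity : 0 ≤ 32 * (r * h)).trans hrh
  have hqt : q * t ≤ 2 / 3 := by nlinarith
  have hu : 0 < 1 - q * t := by linarith
  have hpay : r * (t / β) ≤ r * h := by
    gcongr
    rwa [div_le_iff₀ hβ]
  have hgain : a * (t / β) ≤ d / 32 * t := by
    rw [← mul_div_assoc, div_le_iff₀ hβ]
    nlinarith
  have hlost : r * h * (q * t) ≤ d / 32 * t := by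
    gcongr
    · linarith
    · nlinarith
  have hmove : d / 12 * t ≤ M * (1 - q) * t := by
    gcongr
    nlinarith
  have hdt : 0 ≤ d * t := by positivity
  have hkey : r * (t / β) + a * (t / β) ≤ r * h * (1 - q * t) + M * (1 - q) * t := by
    linarith
  calc (r + a) * (softMin β (Function.update w i (w i + h)) - softMin β w)
      ≤ (r + a) * (q * t / (1 - q * t) / β) := by gcongr
    _ = q / (1 - q * t) * (r * (t / β) + a * (t / β)) := by field_simp
    _ ≤ q / (1 - q * t) * (r * h * (1 - q * t) + M * (1 - q) * t) := by gcongr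
    _ = r * q * h + M * (q - q * Real.exp (-β * h) / (1 - q * t)) := by
      rw [hexp]
      field_simp
      ring

end SoftMin

/-- The potential of a star whose legs have the same ratio. -/
noncomputable def StarPotential.uniform {ι : Type} [Fintype ι] [DecidableEq ι] [Nonempty ι]
    (hcard : 2 ≤ Fintype.card ι) {r d M ε : ℝ} (hr : 0 ≤ r) (hd : 0 < d) (hM : d ≤ 4 * M)
    (hε : 32 * (r * ε) ≤ d) :
    StarPotential (fun _ : ι => r) (r + Real.log (Fintype.card ι) / 32) d M ε
      ((r + Real.log (Fintype.card ι) / 32) * d) :=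
  have hlog : 0 < Real.log (Fintype.card ι) := Real.log_pos (by exact_mod_cast hcard)
  have hβ : 0 < Real.log (Fintype.card ι) / d := div_pos hlog hd
  have hβd : Real.log (Fintype.card ι) / d * d = Real.log (Fintype.card ι) :=
    div_mul_cancel₀ _ hd.ne'
  { val := fun w =>
      (r + Real.log (Fintype.card ι) / 32) * softMin (Real.log (Fintype.card ι) / d) w
    prob := gibbs (Real.log (Fintype.card ι) / d)
    prob_pos := fun i _ => gibbs_pos _ _ i
    sum_prob := sum_gibbs hβ
    val_update_sub_le := fun {w} i h hw hh hhε _ => by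
      rw [← mul_sub]
      refine mul_softMin_update_sub_le hβ i hr (by positivity) (by linarith) hM hh
        (by nlinarith) (gibbs_le_two_thirds hβ hcard ?_ hw i)
      rw [hβd, Real.exp_log (by exact_mod_cast Fintype.card_pos)]
    abs_val_sub_le := fun {w} hw => by
      obtain ⟨i, hmin⟩ := Finite.exists_min w
      have hmax (j : ι) : w j ≤ w i + d := by linarith [hw j i]
      have hsoft := le_softMin hβ hmin
      have hsoft' := softMin_le hβ hmax
      have hmean := Finset.le_expect Finset.univ_nonempty fun j _ => hmin j
      have hmean' := Finset.expect_le Finset.univ_nonempty fun j _ => hmax j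
      rw [← mul_sub, abs_mul, abs_of_nonneg (by positivity)]
      gcongr
      exact abs_sub_le_iff.2 ⟨by linarith, by linarith⟩ }

section LightProb

variable {D M μ : ℝ} {R w : Fin 2 → ℝ}

/-- The probability of the second of two legs at distance `D` in the strategy for unequal ratios,
with rate `μ`. -/
noncomputable def lightProb (D μ : ℝ) (w : Fin 2 → ℝ) : ℝ := Real.exp (μ * ((w 0 - w 1) / D - 2))

/-- The potential of two legs at distance `D` with unequal ratios, where `ρ` is the ratio obtained
and the algorithm moves at rate `M`. -/
noncomputable def twoLegVal (R : Fin 2 → ℝ) (D M μ ρ : ℝ) (w : Fin 2 → ℝ) : ℝ :=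
  ρ * w 0 - (R 1 * (D / μ) + M) * lightProb D μ w

theorem lightProb_pos (D μ : ℝ) (w : Fin 2 → ℝ) : 0 < lightProb D μ w := Real.exp_pos _

theorem lightProb_lt_one (hD : 0 < D) (hμ : 0 < μ) (hw : SpreadLE w (3 / 2 * D)) :
    lightProb D μ w < 1 := by
  have hdiff : (w 0 - w 1) / D ≤ 3 / 2 := (div_le_iff₀ hD).2 (hw 0 1)
  exact Real.exp_lt_one_iff.2 (mul_neg_of_pos_of_neg hμ (by linarith))

theorem exp_neg_four_mul_le_lightProb (hD : 0 < D) (hμ : 0 ≤ μ) (hw : SpreadLE w (3 / 2 * D)) :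
    Real.exp (-4 * μ) ≤ lightProb D μ w := by
  have hdiff : -2 ≤ (w 0 - w 1) / D := (le_div_iff₀ hD).2 (by linarith [hw 1 0])
  exact Real.exp_le_exp.2 (by nlinarith)

theorem mul_le_lightProb_update_zero_sub (hD : 0 < D) (hμ : 0 < μ) (w : Fin 2 → ℝ) (h : ℝ) :
    lightProb D μ w * h ≤
      D / μ * (lightProb D μ (Function.update w 0 (w 0 + h)) - lightProb D μ w) := by
  have hupdate : lightProb D μ (Function.update w 0 (w 0 + h)) =
      lightProb D μ w * Real.exp (μ * h / D) := by
    simp only [lightProb, ← Real.exp_add, Function.update_self, ne_eq, one_ne_zero,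
      not_false_eq_true, Function.update_of_ne]
    ring_nf
  have hz := lightProb_pos D μ w
  calc lightProb D μ w * h = D / μ * (lightProb D μ w * (μ * h / D)) := by field_simp
    _ ≤ D / μ * (lightProb D μ w * (Real.exp (μ * h / D) - 1)) := by
      gcongr
      linarith [Real.add_one_le_exp (μ * h / D)]
    _ = _ := by rw [hupdate]; ring

theorem lightProb_sub_update_one_le (hD : 0 < D) (hμ : 0 < μ) (w : Fin 2 → ℝ) (h : ℝ) :
    D / μ * (lightProb D μ w - lightProb D μ (Function.update w 1 (w 1 + h))) ≤
      lightProb D μ w * h := by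
  have hupdate : lightProb D μ (Function.update w 1 (w 1 + h)) =
      lightProb D μ w * Real.exp (-(μ * h / D)) := by
    simp only [lightProb, ← Real.exp_add, Function.update_self, ne_eq, zero_ne_one,
      not_false_eq_true, Function.update_of_ne]
    ring_nf
  have hz := lightProb_pos D μ w
  calc D / μ * (lightProb D μ w - lightProb D μ (Function.update w 1 (w 1 + h)))
      = D / μ * (lightProb D μ w * (1 - Real.exp (-(μ * h / D)))) := by rw [hupdate]; ring
    _ ≤ D / μ * (lightProb D μ w * (μ * h / D)) := by
      gcongr
      linarith [Real.add_one_le_exp (-(μ * h / D))]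
    _ = lightProb D μ w * h := by field_simp

theorem twoLegVal_update_zero_sub_le (hD : 0 < D) (hμ : 0 < μ) (hRμ : R 0 + 1 = R 1 + μ)
    (hR : 0 ≤ R 1) (hM : D / 2 ≤ M) (hw : SpreadLE w (3 / 2 * D)) {h : ℝ} (hh : 0 ≤ h) :
    twoLegVal R D M μ (R 0 + Real.exp (-4 * μ)) (Function.update w 0 (w 0 + h)) -
        twoLegVal R D M μ (R 0 + Real.exp (-4 * μ)) w ≤
      R 0 * (1 - lightProb D μ w) * h +
        M * (lightProb D μ (Function.update w 0 (w 0 + h)) - lightProb D μ w) := by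
  have hstep := mul_le_lightProb_update_zero_sub hD hμ w h
  have hg := exp_neg_four_mul_le_lightProb hD hμ.le hw
  have hz := lightProb_pos D μ w
  simp only [twoLegVal, Function.update_self]
  set z := lightProb D μ w
  set z' := lightProb D μ (Function.update w 0 (w 0 + h))
  have hinc : 0 ≤ D / μ * (z' - z) := (by positivity : 0 ≤ z * h).trans hstep
  have hmove : μ * (D / μ * (z' - z)) ≤ 2 * M * (z' - z) := by
    have hinc' : 0 ≤ z' - z := nonneg_of_mul_nonneg_right hinc (by positivity)
    rw [← mul_assoc, mul_div_cancel₀ _ hμ.ne']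
    gcongr
    linarith
  have hpay : (R 0 + 1) * (z * h) ≤ R 1 * (D / μ * (z' - z)) + 2 * M * (z' - z) := by
    calc (R 0 + 1) * (z * h) = (R 1 + μ) * (z * h) := by rw [hRμ]
      _ ≤ (R 1 + μ) * (D / μ * (z' - z)) := by gcongr
      _ ≤ _ := by linarith
  have hgh : Real.exp (-4 * μ) * h ≤ z * h := by gcongr
  linarith

theorem twoLegVal_update_one_sub_le (hD : 0 < D) (hμ : 0 < μ) (hR : 0 ≤ R 1) (M ρ : ℝ)
    (w : Fin 2 → ℝ) (h : ℝ) :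
    twoLegVal R D M μ ρ (Function.update w 1 (w 1 + h)) - twoLegVal R D M μ ρ w ≤
      R 1 * lightProb D μ w * h +
        M * (lightProb D μ w - lightProb D μ (Function.update w 1 (w 1 + h))) := by
  have hpay := mul_le_mul_of_nonneg_left (lightProb_sub_update_one_le hD hμ w h) hR
  simp only [twoLegVal, ne_eq, zero_ne_one, not_false_eq_true, Function.update_of_ne]
  linarith

theorem abs_twoLegVal_sub_le {ρ : ℝ} (hD : 0 < D) (hμ : 1 ≤ μ) (hR : 0 ≤ R 1) (hρ : 0 ≤ ρ)
    (hM : 0 ≤ M) (hw : SpreadLE w (3 / 2 * D)) :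
    |twoLegVal R D M μ ρ w - ρ * 𝔼 i, w i| ≤ 3 / 4 * ρ * D + (R 1 * D + M) := by
  have hz := lightProb_pos D μ w
  have hz1 := (lightProb_lt_one hD (one_pos.trans_le hμ) hw).le
  have hmean : twoLegVal R D M μ ρ w - ρ * 𝔼 i, w i =
      ρ * ((w 0 - w 1) / 2) - (R 1 * (D / μ) + M) * lightProb D μ w := by
    rw [twoLegVal, Fintype.expect_eq_sum_div_card, Fin.sum_univ_two, Fintype.card_fin]
    push_cast
    ring
  have hdiff : |(w 0 - w 1) / 2| ≤ 3 / 4 * D :=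
    abs_le.2 ⟨by linarith [hw 1 0], by linarith [hw 0 1]⟩
  rw [hmean]
  refine (abs_sub _ _).trans (add_le_add ?_ ?_)
  · rw [abs_mul, abs_of_nonneg hρ, mul_right_comm, mul_comm]
    gcongr
  · rw [abs_of_nonneg (by positivity)]
    refine (mul_le_of_le_one_right (by positivity) hz1).trans ?_
    gcongr
    exact div_le_self hD.le hμ

end LightProb

/-- The potential of two legs at distance `D` with possibly different ratios. -/
noncomputable def StarPotential.binary {R : Fin 2 → ℝ} {D M : ℝ} (ε : ℝ) (hR₁ : 0 ≤ R 1)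
    (hR : R 1 ≤ R 0) (hD : 0 < D) (hM : D / 2 ≤ M) (hMD : M ≤ D) :
    StarPotential R (R 0 + Real.exp (-4 * (R 0 - R 1 + 1))) (3 / 2 * D) M ε
      ((2 * R 0 + 2) * D) :=
  have hμ : 1 ≤ R 0 - R 1 + 1 := by linarith
  have hμ0 : 0 < R 0 - R 1 + 1 := by linarith
  { val := twoLegVal R D M (R 0 - R 1 + 1) (R 0 + Real.exp (-4 * (R 0 - R 1 + 1)))
    prob := fun w => ![1 - lightProb D (R 0 - R 1 + 1) w, lightProb D (R 0 - R 1 + 1) w]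
    prob_pos := fun i hw => by
      fin_cases i
      · exact sub_pos.2 (lightProb_lt_one hD hμ0 hw)
      · exact lightProb_pos D _ _
    sum_prob := fun w => by simp
    val_update_sub_le := fun {w} i h hw hh _ _ => by
      fin_cases i
      · have hstep := twoLegVal_update_zero_sub_le hD hμ0 (by ring) hR₁ hM hw hh
        simpa using hstep
      · exact twoLegVal_update_one_sub_le hD hμ0 hR₁ M _ w h
    abs_val_sub_le := fun {w} hw => by
      have hexp : Real.exp (-4 * (R 0 - R 1 + 1)) ≤ 1 := Real.exp_le_one_iff.2 (by linarith)
      have hρ : 0 ≤ R 0 + Real.exp (-4 * (R 0 - R 1 + 1)) := by positivity [hR₁.trans hR]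
      refine (abs_twoLegVal_sub_le hD hμ hR₁ hρ (by linarith) hw).trans ?_
      nlinarith }

section Sizes

variable {n : ℕ}

theorem sum_inv_sq_le_one (n : ℕ) : ∑ i : Fin n, (((i : ℝ) + 2) ^ 2)⁻¹ ≤ 1 := by
  have htelescope (i : ℕ) : (((i : ℝ) + 2) ^ 2)⁻¹ ≤ ((i : ℝ) + 1)⁻¹ - ((i + 1 : ℕ) + 1 : ℝ)⁻¹ := by
    rw [inv_sub_inv (by positivity) (by positivity), inv_eq_one_div,
      div_le_div_iff₀ (by positivity) (by positivity)]
    push_cast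
    nlinarith [(Nat.cast_nonneg i : (0 : ℝ) ≤ i)]
  calc ∑ i : Fin n, (((i : ℝ) + 2) ^ 2)⁻¹ = ∑ i ∈ Finset.range n, (((i : ℝ) + 2) ^ 2)⁻¹ :=
        Fin.sum_univ_eq_sum_range (fun i : ℕ => (((i : ℝ) + 2) ^ 2)⁻¹) n
    _ ≤ ∑ i ∈ Finset.range n, (((i : ℝ) + 1)⁻¹ - ((i + 1 : ℕ) + 1 : ℝ)⁻¹) :=
        Finset.sum_le_sum fun i _ => htelescope i
    _ = 1 - ((n : ℝ) + 1)⁻¹ := by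
        rw [Finset.sum_range_sub' (fun i : ℕ => ((i : ℝ) + 1)⁻¹)]
        simp
    _ ≤ 1 := sub_le_self _ (by positivity)

theorem sum_le_of_le_div_sq {a : Fin n → ℝ} {b : ℝ} (hb : 0 ≤ b)
    (ha : ∀ i, a i ≤ b * (((i : ℝ) + 2) ^ 2)⁻¹) : ∑ i, a i ≤ b := by
  calc ∑ i, a i ≤ ∑ i : Fin n, b * (((i : ℝ) + 2) ^ 2)⁻¹ := Finset.sum_le_sum fun i _ => ha i
    _ = b * ∑ i : Fin n, (((i : ℝ) + 2) ^ 2)⁻¹ := (Finset.mul_sum ..).symm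
    _ ≤ b := mul_le_of_le_one_right hb (sum_inv_sq_le_one n)

theorem sum_le_div_four {a : Fin n → ℝ} {s : ℝ} (hs : 0 ≤ s)
    (ha : ∀ i, a i * ((i : ℝ) + 2) ^ 4 ≤ s) : ∑ i, a i ≤ s / 4 := by
  refine sum_le_of_le_div_sq (by positivity) fun i => ?_
  rw [← div_eq_mul_inv, div_div, le_div_iff₀ (by positivity)]
  rcases le_total (a i) 0 with hneg | hpos
  · exact (mul_nonpos_of_nonpos_of_nonneg hneg (by positivity)).trans hs
  · refine (ha i).trans' (mul_le_mul_of_nonneg_left ?_ hpos)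
    nlinarith [(Nat.cast_nonneg i : (0 : ℝ) ≤ (i : ℕ)), sq_nonneg (((i : ℝ) + 2) ^ 2 - 4)]

theorem sum_le_sqrt_mul {a : Fin n → ℝ} {b s : ℝ} (ha : ∀ i, 0 ≤ a i) (hb : ∀ i, a i ≤ b)
    (hs : ∀ i, a i * ((i : ℝ) + 2) ^ 4 ≤ s) : ∑ i, a i ≤ √(b * s) := by
  refine sum_le_of_le_div_sq (Real.sqrt_nonneg _) fun i => ?_
  rw [← div_eq_mul_inv, le_div_iff₀ (by positivity)]
  refine Real.le_sqrt_of_sq_le ?_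
  calc (a i * ((i : ℝ) + 2) ^ 2) ^ 2 = a i * (a i * ((i : ℝ) + 2) ^ 4) := by ring
    _ ≤ b * s := mul_le_mul (hb i) (hs i) (mul_nonneg (ha i) (by positivity)) ((ha i).trans (hb i))

theorem exists_sum_le_or_log_sum_le {N : Fin (n + 2) → ℝ} (hpos : ∀ i, 0 < N i)
    (hanti : Antitone N) :
    (∃ i : Fin (n + 1), ∑ j, N j ≤ N i.succ * ((i : ℝ) + 2) ^ 4) ∨
      Real.log (∑ j, N j) ≤ Real.log (N 0) + 2 * √(N 1 / N 0) := by
  refine or_iff_not_imp_left.2 fun hmany => ?_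
  push Not at hmany
  have hsplit : ∑ j, N j = N 0 + ∑ i : Fin (n + 1), N i.succ := Fin.sum_univ_succ N
  have hsum : 0 < ∑ j, N j := Finset.sum_pos (fun j _ => hpos j) Finset.univ_nonempty
  have hquarter := sum_le_div_four hsum.le fun i => (hmany i).le
  have hsqrt := sum_le_sqrt_mul (fun i => (hpos i.succ).le)
    (fun i => hanti (Fin.succ_le_succ_iff.2 (Fin.zero_le i))) fun i => (hmany i).le
  rw [Fin.succ_zero_eq_one] at hsqrt
  set s := ∑ j, N j
  have hN0 := hpos 0
  have hN1 := hpos 1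
  have htail : √(N 1 * s) ≤ 2 * √(N 1 / N 0) * N 0 := by
    refine Real.sqrt_le_iff.2 ⟨by positivity, ?_⟩
    calc N 1 * s ≤ N 1 * (4 * N 0) := by gcongr; linarith
      _ = (2 * √(N 1 / N 0) * N 0) ^ 2 := by
        rw [mul_pow, mul_pow, Real.sq_sqrt (by positivity)]
        field_simp
        ring
  rw [← sub_le_iff_le_add', ← Real.log_div hsum.ne' hN0.ne']
  refine (Real.log_le_sub_one_of_pos (div_pos hsum hN0)).trans ?_
  rw [sub_le_iff_le_add, div_le_iff₀ hN0]
  linarith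

theorem sqrt_le_mul_exp {v : ℝ} (hv : 0 < v) (hv1 : v ≤ 1) :
    √v ≤ 64 * Real.exp (-4 * (1 - Real.log v / 128)) := by
  have hexp : Real.exp 4 ≤ 64 := by
    calc Real.exp 4 = Real.exp 1 ^ 4 := by rw [← Real.exp_nat_mul]; norm_num
      _ ≤ 2.8 ^ 4 := by gcongr; linarith [Real.exp_one_lt_d9]
      _ ≤ 64 := by norm_num
  calc √v = Real.exp (Real.log v / 2) := by rw [Real.exp_half, Real.exp_log hv]
    _ ≤ Real.exp (4 + -4 * (1 - Real.log v / 128)) :=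
      Real.exp_le_exp.2 (by linarith [Real.log_nonpos hv.le hv1])
    _ ≤ 64 * Real.exp (-4 * (1 - Real.log v / 128)) := by rw [Real.exp_add]; gcongr

end Sizes

theorem exists_filter_eq_of_pairwise_disjoint {X : Type u} {ι : Type} [Fintype ι]
    [DecidableEq ι] [Nonempty ι] [DecidableEq X] {S : ι → Finset X}
    (hS : Pairwise (Function.onFun Disjoint S)) :
    ∃ idx : X → ι, ∀ i, {x ∈ Finset.univ.biUnion S | idx x = i} = S i := by
  have hidx : ∀ x, ∃ i, x ∈ Finset.univ.biUnion S → x ∈ S i := fun x => by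
    by_cases hx : x ∈ Finset.univ.biUnion S
    · obtain ⟨i, -, hi⟩ := Finset.mem_biUnion.1 hx
      exact ⟨i, fun _ => hi⟩
    · exact ⟨Classical.arbitrary ι, fun h => absurd h hx⟩
  choose idx hidx using hidx
  refine ⟨idx, fun i => Finset.ext fun x => ?_⟩
  rw [Finset.mem_filter]
  constructor
  · rintro ⟨hx, rfl⟩
    exact hidx x hx
  · intro hx
    have hxU := Finset.mem_biUnion.2 ⟨i, Finset.mem_univ i, hx⟩
    refine ⟨hxU, by_contra fun hne => ?_⟩
    exact Finset.disjoint_left.1 (hS hne) (hidx x hxU) hx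

section HasAdversary

variable {X : Type u} [MetricSpace X] {L L' T : Finset X} {R R' K K' D : ℝ}

/-- Some subset of `L` carries adversaries of ratio `R` for all small step sizes. Passing to a
subset is what allows an adversary to ignore part of the space. -/
def HasAdversary (L : Finset X) (R K : ℝ) : Prop :=
  ∀ᶠ ε in 𝓝[>] (0 : ℝ), ∃ S ⊆ L, Nonempty (Adversary S ε R K)

theorem HasAdversary.mono (h : HasAdversary L R K) (hL : L ⊆ L') (hR : R' ≤ R) (hK : K ≤ K') :
    HasAdversary L' R' K' :=
  Eventually.mono h fun _ ⟨S, hS, ⟨A⟩⟩ => ⟨S, hS.trans hL, ⟨A.mono hR hK⟩⟩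

theorem hasAdversary_singleton (x : X) : HasAdversary {x} 0 0 :=
  eventually_mem_nhdsWithin.mono fun _ hε => ⟨{x}, subset_rfl, ⟨Adversary.singleton x hε⟩⟩

theorem HasAdversary.combine {ι : Type} [Fintype ι] [DecidableEq ι] [Nonempty ι] {L : ι → Finset X}
    {R : ι → ℝ} {ρ B : ℝ} (hA : ∀ i, HasAdversary (L i) (R i) (D / 4)) (hD : 0 < D)
    (hR : ∀ i, 0 ≤ R i) (hLT : ∀ i, L i ⊆ T)
    (hdist : ∀ i j, i ≠ j → ∀ x ∈ L i, ∀ y ∈ L j, dist x y = D)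
    (hP : ∀ᶠ ε in 𝓝[>] (0 : ℝ), Nonempty (StarPotential R ρ (3 / 2 * D) (D / 2) ε B)) :
    HasAdversary T ρ (B + 3 / 4 * D) := by
  classical
  have hsmall : ∀ᶠ ε in 𝓝[>] (0 : ℝ), ε ∈ Set.Ioc 0 (D / 2) := Ioc_mem_nhdsGT (by positivity)
  filter_upwards [eventually_all.2 hA, hP, hsmall] with ε hA ⟨P⟩ ⟨hε, hεD⟩
  choose S hS A using hA
  have hdisj : Pairwise (Function.onFun Disjoint S) := fun i j hij =>
    Finset.disjoint_left.2 fun x hi hj => hD.ne <|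
      (dist_self x).symm.trans (hdist i j hij x (hS i hi) x (hS j hj))
  obtain ⟨idx, hidx⟩ := exists_filter_eq_of_pairwise_disjoint hdisj
  have hmem : ∀ x ∈ Finset.univ.biUnion S, x ∈ S (idx x) := fun x hx => by
    rw [← hidx]
    exact Finset.mem_filter.2 ⟨hx, rfl⟩
  refine ⟨Finset.univ.biUnion S, Finset.biUnion_subset.2 fun i _ => (hS i).trans (hLT i), ?_⟩
  have hcomb := P.combine (T := Finset.univ.biUnion S) (idx := idx)
    (fun i => (hidx i).symm ▸ (A i).some) hD hε.le (by positivity) (by linarith) hR (by linarith)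
    fun x hx y hy hne => hdist _ _ hne x (hS _ (hmem x hx)) y (hS _ (hmem y hy))
  exact ⟨hcomb.mono le_rfl (by linarith)⟩

theorem HasAdversary.combine_many {n : ℕ} {L : Fin (n + 2) → Finset X}
    (hA : ∀ i, HasAdversary (L i) R (D / 4)) (hD : 0 < D) (hR : 0 ≤ R) (hLT : ∀ i, L i ⊆ T)
    (hdist : ∀ i j, i ≠ j → ∀ x ∈ L i, ∀ y ∈ L j, dist x y = D) :
    HasAdversary T (R + Real.log (n + 2) / 32)
      ((R + Real.log (n + 2) / 32) * (3 / 2 * D) + 3 / 4 * D) := by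
  refine HasAdversary.combine hA hD (fun _ => hR) hLT hdist ?_
  have hsmall : ∀ᶠ ε in 𝓝[>] (0 : ℝ), 32 * (R * ε) ≤ 3 / 2 * D := by
    have hlim : Tendsto (fun ε => 32 * (R * ε)) (𝓝[>] 0) (𝓝 (32 * (R * 0))) :=
      ((tendsto_id.const_mul R).const_mul 32).mono_left nhdsWithin_le_nhds
    exact hlim.eventually_le_const (by linarith)
  filter_upwards [hsmall] with ε hε
  have P := StarPotential.uniform (ι := Fin (n + 2)) (by simp) hR (by positivity : 0 < 3 / 2 * D)
    (by linarith : 3 / 2 * D ≤ 4 * (D / 2)) hε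
  simp only [Fintype.card_fin, Nat.cast_add, Nat.cast_ofNat] at P
  exact ⟨P⟩

theorem HasAdversary.combine_two (hA : HasAdversary L R (D / 4)) (hA' : HasAdversary L' R' (D / 4))
    (hD : 0 < D) (hR' : 0 ≤ R') (hRR' : R' ≤ R) (hLT : L ⊆ T) (hLT' : L' ⊆ T)
    (hdist : ∀ x ∈ L, ∀ y ∈ L', dist x y = D) :
    HasAdversary T (R + Real.exp (-4 * (R - R' + 1))) ((2 * R + 2) * D + 3 / 4 * D) := by
  refine HasAdversary.combine (L := ![L, L']) (R := ![R, R']) (Fin.forall_fin_two.2 ⟨hA, hA'⟩) hD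
    (Fin.forall_fin_two.2 ⟨hR'.trans hRR', hR'⟩) (Fin.forall_fin_two.2 ⟨hLT, hLT'⟩) ?_
    (.of_forall fun ε => ⟨StarPotential.binary ε hR' hRR' hD le_rfl (by linarith)⟩)
  rw [Fin.forall_fin_two]
  refine ⟨Fin.forall_fin_two.2 ⟨by simp, fun _ => hdist⟩,
    Fin.forall_fin_two.2 ⟨fun _ y hy x hx => ?_, by simp⟩⟩
  rw [dist_comm]
  exact hdist x hx y hy

theorem hasAdversary_of_card_le_mul_pow {n : ℕ} {L : Fin (n + 2) → Finset X} (hD : 0 < D)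
    (hanti : Antitone fun i => (L i).card) (hLT : ∀ i, L i ⊆ T) (hnT : n + 2 ≤ T.card)
    (hdist : ∀ i j, i ≠ j → ∀ x ∈ L i, ∀ y ∈ L j, dist x y = D)
    (hA : ∀ i, HasAdversary (L i) (Real.log (L i).card / 128) (D / 4)) {i : Fin (n + 1)}
    (hpos : 0 < (L i.succ).card) (hi : (T.card : ℝ) ≤ (L i.succ).card * ((i : ℝ) + 2) ^ 4) :
    HasAdversary T (Real.log T.card / 128) (4 * Real.log T.card * D) := by
  have hpos' : (0 : ℝ) < (L i.succ).card := by exact_mod_cast hpos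
  have hT : (0 : ℝ) < T.card := by exact_mod_cast (by omega : 0 < T.card)
  have hle : Real.log (L i.succ).card ≤ Real.log T.card :=
    Real.log_le_log hpos' (by exact_mod_cast Finset.card_le_card (hLT i.succ))
  have hlog2 : Real.log 2 ≤ Real.log T.card :=
    Real.log_le_log two_pos (by exact_mod_cast (by omega : 2 ≤ T.card))
  have hin : (i : ℕ) + 2 ≤ n + 2 := by omega
  have hlogi : Real.log ((i : ℝ) + 2) ≤ Real.log T.card :=
    Real.log_le_log (by positivity) (by exact_mod_cast hin.trans hnT)
  have hleg (j : Fin (i + 2)) :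
      HasAdversary (L (Fin.castLE hin j)) (Real.log (L i.succ).card / 128) (D / 4) := by
    have hji : Fin.castLE hin j ≤ i.succ := by simp [Fin.le_def]; omega
    refine (hA _).mono subset_rfl ?_ le_rfl
    gcongr ?_ / 128
    exact Real.log_le_log hpos' (Nat.cast_le.2 (hanti hji))
  refine (HasAdversary.combine_many hleg hD (by positivity) (fun j => hLT _)
    fun a b hab => hdist _ _ ((Fin.castLE_injective hin).ne hab)).mono subset_rfl ?_ ?_
  · have hlogT := Real.log_le_log hT hi
    rw [Real.log_mul hpos'.ne' (by positivity), Real.log_pow] at hlogT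
    push_cast at hlogT
    linarith
  · nlinarith [Real.log_two_gt_d9]

theorem hasAdversary_of_log_card_le (hD : 0 < D) (hLT : L ⊆ T) (hLT' : L' ⊆ T)
    (hT : 2 ≤ T.card) (hpos : 0 < L'.card) (hcard : L'.card ≤ L.card)
    (hlog : Real.log T.card ≤ Real.log L.card + 2 * √(L'.card / L.card))
    (hdist : ∀ x ∈ L, ∀ y ∈ L', dist x y = D)
    (hA : HasAdversary L (Real.log L.card / 128) (D / 4))
    (hA' : HasAdversary L' (Real.log L'.card / 128) (D / 4)) :
    HasAdversary T (Real.log T.card / 128) (4 * Real.log T.card * D) := by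
  have hpos' : (0 : ℝ) < L'.card := by exact_mod_cast hpos
  have hcard' : (L'.card : ℝ) ≤ L.card := by exact_mod_cast hcard
  have hLpos : (0 : ℝ) < L.card := hpos'.trans_le hcard'
  have hle : Real.log L.card ≤ Real.log T.card :=
    Real.log_le_log hLpos (by exact_mod_cast Finset.card_le_card hLT)
  have hlog2 : Real.log 2 ≤ Real.log T.card := Real.log_le_log two_pos (by exact_mod_cast hT)
  have hLL' : Real.log L'.card / 128 ≤ Real.log L.card / 128 := by gcongr
  refine (hA.combine_two hA' hD (by positivity) hLL' hLT hLT' hdist).mono subset_rfl ?_ ?_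
  · have hsqrt := sqrt_le_mul_exp (div_pos hpos' hLpos) ((div_le_one hLpos).2 hcard')
    have hexp : 1 - Real.log (L'.card / L.card) / 128 =
        Real.log L.card / 128 - Real.log L'.card / 128 + 1 := by
      rw [Real.log_div hpos'.ne' hLpos.ne']
      ring
    rw [hexp] at hsqrt
    linarith
  · nlinarith [Real.log_two_gt_d9]

theorem hasAdversary_of_antitone_card {n : ℕ} {L : Fin (n + 2) → Finset X} (hD : 0 < D)
    (hne : ∀ i, (L i).Nonempty) (hanti : Antitone fun i => (L i).card) (hLT : ∀ i, L i ⊆ T)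
    (hcard : T.card = ∑ i, (L i).card)
    (hdist : ∀ i j, i ≠ j → ∀ x ∈ L i, ∀ y ∈ L j, dist x y = D)
    (hA : ∀ i, HasAdversary (L i) (Real.log (L i).card / 128) (D / 4)) :
    HasAdversary T (Real.log T.card / 128) (4 * Real.log T.card * D) := by
  have hnT : n + 2 ≤ T.card := by
    rw [hcard]
    simpa using Finset.card_nsmul_le_sum Finset.univ (fun i => (L i).card) 1
      fun i _ => (hne i).card_pos
  have hdichotomy := exists_sum_le_or_log_sum_le (N := fun i => ((L i).card : ℝ))
    (fun i => by exact_mod_cast (hne i).card_pos) fun i j hij => Nat.cast_le.2 (hanti hij)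
  rw [← Nat.cast_sum, ← hcard] at hdichotomy
  obtain ⟨i, hi⟩ | htwo := hdichotomy
  · exact hasAdversary_of_card_le_mul_pow hD hanti hLT hnT hdist hA (hne i.succ).card_pos hi
  · exact hasAdversary_of_log_card_le hD (hLT 0) (hLT 1) (by omega) (hne 1).card_pos
      (hanti (Fin.zero_le 1)) htwo (hdist 0 1 (by simp)) (hA 0) (hA 1)

theorem hasAdversary_of_equidistant {κ : Type} [Fintype κ] [Nontrivial κ] {L : κ → Finset X}
    (hD : 0 < D) (hne : ∀ i, (L i).Nonempty) (hLT : ∀ i, L i ⊆ T)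
    (hcard : T.card = ∑ i, (L i).card)
    (hdist : ∀ i j, i ≠ j → ∀ x ∈ L i, ∀ y ∈ L j, dist x y = D)
    (hA : ∀ i, HasAdversary (L i) (Real.log (L i).card / 128) (D / 4)) :
    HasAdversary T (Real.log T.card / 128) (4 * Real.log T.card * D) := by
  obtain ⟨n, hn⟩ := Nat.exists_eq_add_of_le' (Fintype.one_lt_card (α := κ))
  let e := (Fintype.equivFinOfCardEq hn).symm
  let size : Fin (n + 2) → ℕᵒᵈ := fun i => OrderDual.toDual (L (e i)).card
  let σ : Fin (n + 2) ≃ κ := (Tuple.sort size).trans e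
  have hanti : Antitone fun i => (L (σ i)).card := fun i j hij => Tuple.monotone_sort size hij
  refine hasAdversary_of_antitone_card hD (fun i => hne _) hanti (fun i => hLT _) ?_
    (fun i j hij => hdist _ _ (σ.injective.ne hij)) fun i => hA _
  rw [hcard, Equiv.sum_comp σ fun i => (L i).card]

end HasAdversary

section Tree

variable {X : Type u} {T : RootedTree.{0}} {v w a b : T}

theorem eq_of_covBy_of_le (ha : v ⋖ a) (hb : v ⋖ b) (haw : a ≤ w) (hbw : b ≤ w) : a = b := by
  obtain hba | hab := le_total_of_directed haw hbw
  · exact ((ha.eq_or_eq hb.le hba).resolve_left hb.lt.ne').symm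
  · exact (hb.eq_or_eq ha.le hab).resolve_left ha.lt.ne'

theorem inf_eq_of_covBy [Finite T] {w' : T} (ha : v ⋖ a) (hb : v ⋖ b) (hab : a ≠ b) (haw : a ≤ w)
    (hbw : b ≤ w') : w ⊓ w' = v := by
  have hle : v ≤ w ⊓ w' := le_inf (ha.le.trans haw) (hb.le.trans hbw)
  refine (hle.eq_of_not_lt fun hlt => hab ?_).symm
  obtain ⟨c, hc, hcw⟩ := exists_covBy_le_of_lt hlt
  exact (eq_of_covBy_of_le ha hc haw (hcw.trans inf_le_left)).trans
    (eq_of_covBy_of_le hb hc hbw (hcw.trans inf_le_right)).symm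

variable [Fintype X] {leaf : X ≃ {w : T // IsMax w}} {x : X}

open Classical in
/-- The points of an HST whose leaves lie below the vertex `v`, including `v` itself. -/
noncomputable def leavesBelow (leaf : X ≃ {w : T // IsMax w}) (v : T) : Finset X :=
  {x | v ≤ leaf x}

theorem mem_leavesBelow : x ∈ leavesBelow leaf v ↔ v ≤ leaf x := by simp [leavesBelow]

theorem leavesBelow_bot (leaf : X ≃ {w : T // IsMax w}) : leavesBelow leaf ⊥ = Finset.univ :=
  Finset.eq_univ_of_forall fun _ => mem_leavesBelow.2 bot_le

theorem leavesBelow_antitone (leaf : X ≃ {w : T // IsMax w}) : Antitone (leavesBelow leaf) :=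
  fun _ _ hvw _ hx => mem_leavesBelow.2 (hvw.trans (mem_leavesBelow.1 hx))

theorem leavesBelow_leaf (leaf : X ≃ {w : T // IsMax w}) (x : X) :
    leavesBelow leaf (leaf x : T) = {x} := by
  ext y
  rw [mem_leavesBelow, Finset.mem_singleton]
  refine ⟨fun hxy => ?_, fun hyx => by rw [hyx]⟩
  exact (leaf.injective (Subtype.ext ((leaf x).2.eq_of_le hxy))).symm

theorem leavesBelow_nonempty [Finite T] (leaf : X ≃ {w : T // IsMax w}) (v : T) :
    (leavesBelow leaf v).Nonempty := by
  obtain ⟨w, hvw, hw⟩ := Finite.exists_le_maximal (p := fun _ : T => True) (a := v) trivial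
  obtain ⟨x, hx⟩ := leaf.surjective ⟨w, maximal_true.1 hw⟩
  exact ⟨x, mem_leavesBelow.2 (by rwa [hx])⟩

theorem exists_covBy_of_mem_leavesBelow [Finite T] (hv : ¬IsMax v) (hx : x ∈ leavesBelow leaf v) :
    ∃ u, v ⋖ u ∧ x ∈ leavesBelow leaf u := by
  have hne : v ≠ leaf x := fun h => hv (h ▸ (leaf x).2)
  obtain ⟨u, hvu, hux⟩ := exists_covBy_le_of_lt ((mem_leavesBelow.1 hx).lt_of_ne hne)
  exact ⟨u, hvu, mem_leavesBelow.2 hux⟩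

theorem card_leavesBelow [Finite T] [Fintype {u : T // v ⋖ u}] (hv : ¬IsMax v) :
    (leavesBelow leaf v).card = ∑ u : {u : T // v ⋖ u}, (leavesBelow leaf u.1).card := by
  classical
  rw [← Finset.card_biUnion]
  · congr 1
    ext x
    simp only [Finset.mem_biUnion, Finset.mem_univ, true_and, Subtype.exists, exists_prop]
    exact ⟨exists_covBy_of_mem_leavesBelow hv,
      fun ⟨u, hvu, hx⟩ => leavesBelow_antitone leaf hvu.le hx⟩
  · rintro ⟨a, ha⟩ - ⟨b, hb⟩ - hab
    refine Finset.disjoint_left.2 fun x hxa hxb => hab (Subtype.ext ?_)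
    exact eq_of_covBy_of_le ha hb (mem_leavesBelow.1 hxa) (mem_leavesBelow.1 hxb)

theorem exists_covBy_leavesBelow_eq [Finite T] [Subsingleton {u : T // v ⋖ u}]
    (leaf : X ≃ {w : T // IsMax w}) (hv : ¬IsMax v) :
    ∃ u, v ⋖ u ∧ leavesBelow leaf v = leavesBelow leaf u := by
  obtain ⟨x, hx⟩ := leavesBelow_nonempty leaf v
  obtain ⟨u, hvu, -⟩ := exists_covBy_of_mem_leavesBelow hv hx
  refine ⟨u, hvu, Finset.Subset.antisymm (fun y hy => ?_) (leavesBelow_antitone leaf hvu.le)⟩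
  obtain ⟨u', hvu', hyu'⟩ := exists_covBy_of_mem_leavesBelow hv hy
  obtain rfl : u = u' := congrArg Subtype.val (Subsingleton.elim (Subtype.mk u hvu) ⟨u', hvu'⟩)
  exact hyu'

theorem IsHST.hasAdversary [MetricSpace X] {k : ℝ} (hk1 : 1 ≤ k)
    (hk : 16 * Real.log (Fintype.card X) ≤ k) (h : IsHST k X) :
    ∃ K, HasAdversary (Finset.univ : Finset X) (Real.log (Fintype.card X) / 128) K := by
  obtain ⟨T, Δ, leaf, _, hΔ0, hΔ, hchild, hdist⟩ := h
  suffices hvertex : ∀ v : T, HasAdversary (leavesBelow leaf v)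
      (Real.log (leavesBelow leaf v).card / 128) (4 * Real.log (leavesBelow leaf v).card * Δ v) by
    have hroot := hvertex ⊥
    rw [leavesBelow_bot] at hroot
    exact ⟨_, hroot⟩
  intro v
  induction v using WellFoundedGT.induction with | ind v ih
  by_cases hv : IsMax v
  · obtain ⟨x, hx⟩ := leaf.surjective ⟨v, hv⟩
    obtain rfl : (leaf x : T) = v := by rw [hx]
    simpa [leavesBelow_leaf] using hasAdversary_singleton x
  have hD : 0 < Δ v := (hΔ0 v).lt_of_ne' (mt (hΔ v).1 hv)
  have : Fintype {u : T // v ⋖ u} := Fintype.ofFinite _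
  obtain hone | _ := subsingleton_or_nontrivial {u : T // v ⋖ u}
  · obtain ⟨u, hvu, hu⟩ := exists_covBy_leavesBelow_eq leaf hv
    rw [hu]
    refine (ih u hvu.lt).mono subset_rfl le_rfl ?_
    gcongr
    exact (hchild v u hvu).trans (div_le_self (hΔ0 v) hk1)
  · refine hasAdversary_of_equidistant (L := fun u : {u : T // v ⋖ u} => leavesBelow leaf u.1) hD
      (fun u => leavesBelow_nonempty leaf u.1) (fun u => leavesBelow_antitone leaf u.2.le)
      (card_leavesBelow hv) ?_ fun ⟨u, hvu⟩ => ?_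
    · rintro ⟨a, ha⟩ ⟨b, hb⟩ hab x hx y hy
      rw [hdist, inf_eq_of_covBy ha hb (fun h => hab (Subtype.ext h)) (mem_leavesBelow.1 hx)
        (mem_leavesBelow.1 hy)]
    · refine (ih u hvu.lt).mono subset_rfl le_rfl ?_
      have hlog : Real.log (leavesBelow leaf u).card ≤ Real.log (Fintype.card X) :=
        Real.log_le_log (by exact_mod_cast (leavesBelow_nonempty leaf u).card_pos)
          (by exact_mod_cast Finset.card_le_univ _)
      have hΔu : Δ u * k ≤ Δ v := (le_div_iff₀ (by positivity)).1 (hchild v u hvu)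
      nlinarith [hΔ0 u]

end Tree

section WorkFunction

variable {X : Type u} [MetricSpace X]

theorem serviceCost_eq_sum_range (σ : List (MTSTask X)) (s : ℕ → X) :
    serviceCost σ s = ∑ i ∈ Finset.range σ.length,
      (edist (s i) (s (i + 1)) + σ.getD i 0 (s (i + 1))) := by
  rw [serviceCost, ← Fin.sum_univ_eq_sum_range
    fun i => edist (s i) (s (i + 1)) + σ.getD i 0 (s (i + 1))]
  refine Finset.sum_congr rfl fun i _ => ?_
  rw [List.getD_eq_getElem _ _ i.2]
  rfl

theorem serviceCost_congr (σ : List (MTSTask X)) {s s' : ℕ → X}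
    (h : ∀ i ≤ σ.length, s i = s' i) : serviceCost σ s = serviceCost σ s' := by
  rw [serviceCost_eq_sum_range, serviceCost_eq_sum_range]
  refine Finset.sum_congr rfl fun i hi => ?_
  have hi' := Finset.mem_range.1 hi
  rw [h i hi'.le, h (i + 1) hi']

theorem serviceCost_append_singleton (σ : List (MTSTask X)) (τ : MTSTask X) (s : ℕ → X) :
    serviceCost (σ ++ [τ]) s = serviceCost σ s +
      (edist (s σ.length) (s (σ.length + 1)) + τ (s (σ.length + 1))) := by
  rw [serviceCost_eq_sum_range, serviceCost_eq_sum_range, List.length_append,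
    List.length_singleton, Finset.sum_range_succ]
  congr 1
  · refine Finset.sum_congr rfl fun i hi => ?_
    rw [List.getD_append _ _ _ _ (Finset.mem_range.1 hi)]
  · rw [List.getD_append_right _ _ _ _ le_rfl]
    simp

/-- The work function of `σ` at `x` is at most `a`: some schedule starting in `x₀` and ending in
`x` serves `σ` at cost at most `a`. -/
def WorkLE (x₀ : X) (σ : List (MTSTask X)) (x : X) (a : ℝ) : Prop :=
  0 ≤ a ∧ ∃ s : ℕ → X, s 0 = x₀ ∧ s σ.length = x ∧ serviceCost σ s ≤ ENNReal.ofReal a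

variable {x₀ x y : X} {σ : List (MTSTask X)} {τ : MTSTask X} {a b t : ℝ}

theorem workLE_nil (x₀ : X) : WorkLE x₀ [] x₀ 0 :=
  ⟨le_rfl, fun _ => x₀, rfl, rfl, by simp [serviceCost]⟩

theorem WorkLE.mono (h : WorkLE x₀ σ x a) (hab : a ≤ b) : WorkLE x₀ σ x b := by
  obtain ⟨ha, s, hstart, hend, hcost⟩ := h
  exact ⟨ha.trans hab, s, hstart, hend, hcost.trans (ENNReal.ofReal_le_ofReal hab)⟩

theorem WorkLE.append_singleton (h : WorkLE x₀ σ y a) (ht : 0 ≤ t)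
    (hτ : τ x ≤ ENNReal.ofReal t) : WorkLE x₀ (σ ++ [τ]) x (a + dist y x + t) := by
  obtain ⟨ha, s, hstart, hend, hcost⟩ := h
  refine ⟨by positivity, fun i => if i ≤ σ.length then s i else x, by simpa using hstart,
    by simp, ?_⟩
  rw [serviceCost_append_singleton, serviceCost_congr σ (s' := s) fun i hi => by simp [hi],
    add_assoc a, ENNReal.ofReal_add ha (by positivity), ENNReal.ofReal_add dist_nonneg ht]
  simp only [le_refl, if_true, hend, Nat.not_succ_le_self, if_false]
  rw [edist_dist]
  gcongr

theorem WorkLE.optCost_le (h : WorkLE x₀ σ x a) : optCost x₀ σ ≤ ENNReal.ofReal a := by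
  obtain ⟨-, s, hstart, -, hcost⟩ := h
  exact (iInf₂_le s hstart).trans hcost

end WorkFunction

open Classical in
/-- The task `τ` made prohibitive outside `F`. -/
noncomputable def confine {X : Type u} (F : Set X) (τ : MTSTask X) : MTSTask X :=
  fun x => if x ∈ F then τ x else ⊤

theorem confine_of_mem {X : Type u} {F : Set X} {x : X} (hx : x ∈ F) (τ : MTSTask X) :
    confine F τ x = τ x :=
  if_pos hx

theorem confine_of_notMem {X : Type u} {F : Set X} {x : X} (hx : x ∉ F) (τ : MTSTask X) :
    confine F τ x = ⊤ :=
  if_neg hx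

namespace RandomizedOnlineAlgorithm

variable {X : Type u} {x₀ : X} {A : RandomizedOnlineAlgorithm.{u, v} X x₀} {σ σ' : List (MTSTask X)}
  {τ : MTSTask X}

/-- The probability of occupying `x` after the tasks `σ`. -/
noncomputable def prob (A : RandomizedOnlineAlgorithm.{u, v} X x₀)
    (σ : List (MTSTask X)) (x : X) : ℝ :=
  A.μ.real {ω | A.state ω σ = x}

theorem prob_eq_zero {F : Set X} (hF : ∀ᵐ ω ∂A.μ, A.state ω σ ∈ F) {x : X} (hx : x ∉ F) :
    A.prob σ x = 0 :=
  (measureReal_eq_zero_iff).2 <| measure_mono_null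
    (fun ω (hω : A.state ω σ = x) (h : A.state ω σ ∈ F) => hx (hω ▸ h)) (ae_iff.1 hF)

theorem mul_ofReal_prob_le_lintegral (A : RandomizedOnlineAlgorithm.{u, v} X x₀)
    (σ : List (MTSTask X)) (τ : MTSTask X) (x : X) :
    τ x * ENNReal.ofReal (A.prob σ x) ≤ ∫⁻ ω, τ (A.state ω σ) ∂A.μ := by
  rw [prob, ofReal_measureReal, ← lintegral_indicator_const (A.measurableSet_state σ x)]
  exact lintegral_mono (Set.indicator_le' (fun ω hω => (congrArg τ hω).ge) fun _ _ => zero_le)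

/-- The expected distance between the states occupied after `σ` and after `σ'`. -/
noncomputable def moveCost [MetricSpace X] (A : RandomizedOnlineAlgorithm.{u, v} X x₀)
    (σ σ' : List (MTSTask X)) : ℝ :=
  ∫ ω, dist (A.state ω σ) (A.state ω σ') ∂A.μ

theorem moveCost_nonneg [MetricSpace X] (A : RandomizedOnlineAlgorithm.{u, v} X x₀)
    (σ σ' : List (MTSTask X)) :
    0 ≤ A.moveCost σ σ' :=
  integral_nonneg fun _ => dist_nonneg

theorem IsCompetitive.exists_expectedCost_le [MetricSpace X] {r : ℝ≥0} (hA : A.IsCompetitive r) :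
    ∃ c : ℝ, ∀ σ x a, WorkLE x₀ σ x a →
      A.expectedCost σ ≠ ⊤ ∧ (A.expectedCost σ).toReal ≤ r * a + c := by
  obtain ⟨c, hc⟩ := hA
  refine ⟨c, fun σ x a h => ?_⟩
  have hle : A.expectedCost σ ≤ ENNReal.ofReal (r * a + c) := by
    rw [ENNReal.ofReal_add (mul_nonneg r.coe_nonneg h.1) c.coe_nonneg,
      ENNReal.ofReal_mul r.coe_nonneg, ENNReal.ofReal_coe_nnreal, ENNReal.ofReal_coe_nnreal]
    exact (hc σ).trans (by gcongr; exact h.optCost_le)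
  exact ⟨ne_top_of_le_ne_top ENNReal.ofReal_ne_top hle,
    ENNReal.toReal_le_of_le_ofReal (by have := h.1; positivity) hle⟩

variable [Finite X]

theorem measurable_comp_state (A : RandomizedOnlineAlgorithm.{u, v} X x₀)
    (σ σ' : List (MTSTask X)) {β : Type*} [MeasurableSpace β] (f : X → X → β) :
    Measurable fun ω => f (A.state ω σ) (A.state ω σ') := by
  intro s _
  have hpreimage : (fun ω => f (A.state ω σ) (A.state ω σ')) ⁻¹' s =
      ⋃ q ∈ {q : X × X | f q.1 q.2 ∈ s}, {ω | A.state ω σ = q.1} ∩ {ω | A.state ω σ' = q.2} := by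
    ext ω
    simp
  rw [hpreimage]
  exact .biUnion (Set.to_countable _) fun q _ =>
    (A.measurableSet_state σ q.1).inter (A.measurableSet_state σ' q.2)

theorem integrable_comp_state (A : RandomizedOnlineAlgorithm.{u, v} X x₀)
    (σ σ' : List (MTSTask X)) (f : X → X → ℝ) :
    Integrable (fun ω => f (A.state ω σ) (A.state ω σ')) A.μ := by
  obtain ⟨C, hC⟩ := (Set.finite_range fun q : X × X => ‖f q.1 q.2‖).bddAbove
  exact .of_bound (A.measurable_comp_state σ σ' f).aestronglyMeasurable C
    (.of_forall fun ω => hC ⟨(A.state ω σ, A.state ω σ'), rfl⟩)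

theorem integral_comp_state {S : Finset X} (hS : ∀ᵐ ω ∂A.μ, A.state ω σ ∈ S) (f : X → ℝ) :
    ∫ ω, f (A.state ω σ) ∂A.μ = ∑ x ∈ S, f x * A.prob σ x := by
  have := Fintype.ofFinite X
  let _ : MeasurableSpace X := ⊤
  have hstate : Measurable fun ω => A.state ω σ := A.measurable_comp_state σ σ fun x _ => x
  rw [← integral_map hstate.aemeasurable (by fun_prop), integral_fintype .of_finite,
    ← Finset.sum_subset S.subset_univ fun x _ hx => ?_]
  · refine Finset.sum_congr rfl fun x _ => ?_
    rw [map_measureReal_apply hstate (measurableSet_singleton x), smul_eq_mul, mul_comm]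
    rfl
  · rw [map_measureReal_apply hstate (measurableSet_singleton x)]
    exact smul_eq_zero_of_left (prob_eq_zero hS hx) _

theorem sum_prob_eq_one {S : Finset X} (hS : ∀ᵐ ω ∂A.μ, A.state ω σ ∈ S) :
    ∑ x ∈ S, A.prob σ x = 1 := by
  simpa using (integral_comp_state hS fun _ => 1).symm

theorem abs_sum_mul_prob_le {S : Finset X} (hS : ∀ᵐ ω ∂A.μ, A.state ω σ ∈ S) {f : X → ℝ} {K : ℝ}
    (hf : ∀ x ∈ S, |f x| ≤ K) : |∑ x ∈ S, f x * A.prob σ x| ≤ K := by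
  rw [← integral_comp_state hS]
  have hae : ∀ᵐ ω ∂A.μ, ‖f (A.state ω σ)‖ ≤ K := hS.mono fun ω hω => hf _ hω
  simpa using norm_integral_le_of_norm_le_const hae

variable [MetricSpace X]

theorem sum_mul_prob_sub_le {S : Finset X} {f : X → ℝ} {C : ℝ≥0} (hf : LipschitzOnWith C f S)
    (hσ : ∀ᵐ ω ∂A.μ, A.state ω σ ∈ S) (hσ' : ∀ᵐ ω ∂A.μ, A.state ω σ' ∈ S) :
    ∑ x ∈ S, f x * A.prob σ' x - ∑ x ∈ S, f x * A.prob σ x ≤ C * A.moveCost σ σ' := by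
  rw [← integral_comp_state hσ, ← integral_comp_state hσ', moveCost, ← integral_const_mul,
    ← integral_sub (A.integrable_comp_state σ' σ fun x _ => f x)
      (A.integrable_comp_state σ σ' fun x _ => f x)]
  refine integral_mono_ae (A.integrable_comp_state σ' σ fun x y => f x - f y)
    (A.integrable_comp_state σ σ' fun x y => C * dist x y) ?_
  filter_upwards [hσ, hσ'] with ω hω hω'
  have hdist := hf.dist_le_mul _ hω' _ hω
  rw [dist_comm (A.state ω σ')] at hdist
  exact (le_abs_self _).trans hdist

theorem lintegral_edist_state (A : RandomizedOnlineAlgorithm.{u, v} X x₀)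
    (σ σ' : List (MTSTask X)) :
    ∫⁻ ω, edist (A.state ω σ) (A.state ω σ') ∂A.μ = ENNReal.ofReal (A.moveCost σ σ') := by
  rw [moveCost, ofReal_integral_eq_lintegral_ofReal (A.integrable_comp_state σ σ' dist)
    (.of_forall fun _ => dist_nonneg)]
  simp only [edist_dist]

theorem expectedCost_append_singleton_ge (A : RandomizedOnlineAlgorithm.{u, v} X x₀)
    (σ : List (MTSTask X)) (τ : MTSTask X) :
    A.expectedCost σ + (ENNReal.ofReal (A.moveCost σ (σ ++ [τ])) +
      ∫⁻ ω, τ (A.state ω (σ ++ [τ])) ∂A.μ) ≤ A.expectedCost (σ ++ [τ]) := by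
  rw [← lintegral_edist_state]
  refine (add_le_add_right (le_lintegral_add _ _) _).trans ((le_lintegral_add _ _).trans ?_)
  refine lintegral_mono fun ω => le_of_eq ?_
  rw [serviceCost_append_singleton]
  congr 1
  · refine serviceCost_congr σ fun i hi => ?_
    rw [List.take_append_of_le_length hi]
  · rw [List.take_left, List.take_of_length_le (by simp)]

theorem ae_mem_of_confine {F : Set X} (hfin : A.expectedCost (σ ++ [confine F τ]) ≠ ⊤) :
    ∀ᵐ ω ∂A.μ, A.state ω (σ ++ [confine F τ]) ∈ F := by
  have hle := A.expectedCost_append_singleton_ge σ (confine F τ)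
  rw [← add_assoc] at hle
  have htask := ne_top_of_le_ne_top hfin (le_add_self.trans hle)
  filter_upwards [ae_lt_top (A.measurable_comp_state _ [] fun x _ => confine F τ x) htask]
    with ω hω
  by_contra hF
  exact hω.ne (confine_of_notMem hF τ)

theorem toReal_expectedCost_append_singleton_ge (hfin : A.expectedCost (σ ++ [τ]) ≠ ⊤) {x : X}
    {t : ℝ} (ht : 0 ≤ t) (hx : ENNReal.ofReal t ≤ τ x) :
    (A.expectedCost σ).toReal + A.moveCost σ (σ ++ [τ]) + t * A.prob (σ ++ [τ]) x ≤
      (A.expectedCost (σ ++ [τ])).toReal := by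
  have hle := A.expectedCost_append_singleton_ge σ τ
  have hσ : A.expectedCost σ ≠ ⊤ := ne_top_of_le_ne_top hfin (le_self_add.trans hle)
  have hmove := A.moveCost_nonneg σ (σ ++ [τ])
  have htask : 0 ≤ t * A.prob (σ ++ [τ]) x := mul_nonneg ht measureReal_nonneg
  rw [← ENNReal.ofReal_le_iff_le_toReal hfin, add_assoc,
    ENNReal.ofReal_add ENNReal.toReal_nonneg (add_nonneg hmove htask),
    ENNReal.ofReal_add hmove htask, ENNReal.ofReal_toReal hσ, ENNReal.ofReal_mul ht]
  refine hle.trans' ?_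
  gcongr
  exact (A.mul_ofReal_prob_le_lintegral _ τ x).trans' (by gcongr)

end RandomizedOnlineAlgorithm

theorem lipschitzWith_indicator_singleton {X : Type u} [MetricSpace X] {θ : ℝ≥0} {t : ℝ}
    (hsep : ∀ x y : X, x ≠ y → t ≤ θ * dist x y) (ht : 0 ≤ t) (l : X) :
    LipschitzWith θ (Set.indicator {l} fun _ => t) := by
  refine .of_dist_le_mul fun x y => ?_
  by_cases hxy : x = y
  · simp [hxy]
  · refine (abs_sub_le_of_nonneg_of_le (Set.indicator_nonneg (fun _ _ => ht) x)
      (Set.indicator_le_self' (fun _ _ => ht) x) (Set.indicator_nonneg (fun _ _ => ht) y)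
      (Set.indicator_le_self' (fun _ _ => ht) y)).trans (hsep x y hxy)

/-- The situation after the tasks `σ`, when the adversary `B` is in state `s` and the points of `S`
outside `F` are forbidden: the work function is bounded by `B.work s` on `F`, the algorithm is
in `F`, and its expected cost has paid for the potential up to a factor `1 + θ` and a constant `b`.
The factor absorbs the error made by charging the algorithm only after it has moved. -/
structure Play {X : Type u} [MetricSpace X] {x₀ : X} {S : Finset X} {ε R K : ℝ}
    (B : Adversary S ε R K) (A : RandomizedOnlineAlgorithm.{u, v} X x₀) (θ : ℝ≥0) (b : ℝ)
    (F : Set X) (s : B.State) (σ : List (MTSTask X)) : Prop where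
  workLE : ∀ x ∈ S, x ∈ F → WorkLE x₀ σ x (B.work s x)
  ae_mem : ∀ᵐ ω ∂A.μ, A.state ω σ ∈ ↑S ∩ F
  potential_le : R * B.level s + ∑ x ∈ S, B.price s x * A.prob σ x ≤
    (1 + θ) * (A.expectedCost σ).toReal + b

namespace Play

variable {X : Type u} [MetricSpace X] [Finite X] {x₀ : X} {S : Finset X} {ε R K b : ℝ}
  {B : Adversary S ε R K} {A : RandomizedOnlineAlgorithm.{u, v} X x₀} {θ r : ℝ≥0} {s : B.State}
  {σ : List (MTSTask X)}

theorem exists_fresh (hA : A.IsCompetitive r) (B : Adversary S ε R K) (θ : ℝ≥0) :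
    ∃ b s σ, Play B A θ b Set.univ s σ := by
  obtain ⟨c, hcost⟩ := hA.exists_expectedCost_le
  obtain ⟨a, ha⟩ := (Set.finite_range (dist x₀)).bddAbove
  set τ := confine (S : Set X) 0
  have hwork : ∀ x ∈ S, WorkLE x₀ ([] ++ [τ]) x (B.work (B.fresh a) x) := fun x hx => by
    refine ((workLE_nil x₀).append_singleton (τ := τ) le_rfl
      ((confine_of_mem (Finset.mem_coe.2 hx) 0).trans_le zero_le)).mono ?_
    simpa [B.work_fresh a x hx] using ha ⟨x, rfl⟩
  obtain ⟨y, hy, -⟩ := B.exists_work_le (B.fresh a)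
  have hmem := RandomizedOnlineAlgorithm.ae_mem_of_confine (hcost _ _ _ (hwork y hy)).1
  refine ⟨R * a + K, B.fresh a, [] ++ [τ], fun x hx _ => hwork x hx,
    hmem.mono fun _ hx => ⟨hx, trivial⟩, ?_⟩
  have hprice := (abs_le.1 (RandomizedOnlineAlgorithm.abs_sum_mul_prob_le hmem
    (B.abs_price_le (B.fresh a)))).2
  have hnonneg : 0 ≤ (1 + θ) * (A.expectedCost ([] ++ [τ])).toReal := by positivity
  rw [B.level_fresh]
  linarith

theorem potential_append_singleton_le {F : Set X} (h : Play B A θ b F s σ) {τ : MTSTask X}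
    (hfin : A.expectedCost (σ ++ [τ]) ≠ ⊤) (hmem : ∀ᵐ ω ∂A.μ, A.state ω (σ ++ [τ]) ∈ S)
    {l : X} (hl : l ∈ S) {t : ℝ} (ht : 0 ≤ t) (hτ : ENNReal.ofReal t ≤ τ l) {s' : B.State}
    (hlip : LipschitzOnWith (1 + θ) (B.price s' - Set.indicator {l} fun _ => t) S)
    (hstep : R * B.level s' + ∑ x ∈ S, B.price s' x * A.prob σ x ≤
      R * B.level s + ∑ x ∈ S, B.price s x * A.prob σ x + t * A.prob σ l) :
    R * B.level s' + ∑ x ∈ S, B.price s' x * A.prob (σ ++ [τ]) x ≤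
      (1 + θ) * (A.expectedCost (σ ++ [τ])).toReal + b := by
  classical
  have hmove := RandomizedOnlineAlgorithm.sum_mul_prob_sub_le hlip
    (h.ae_mem.mono fun _ => And.left) hmem
  simp only [Pi.sub_apply, sub_mul, Finset.sum_sub_distrib, Set.indicator_apply,
    Set.mem_singleton_iff, ite_mul, zero_mul, Finset.sum_ite_eq', if_pos hl, NNReal.coe_add,
    NNReal.coe_one] at hmove
  have hpaid := mul_le_mul_of_nonneg_left
    (RandomizedOnlineAlgorithm.toReal_expectedCost_append_singleton_ge hfin ht hτ)
    (by positivity : (0 : ℝ) ≤ 1 + θ)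
  have hcharge : 0 ≤ θ * (t * A.prob (σ ++ [τ]) l) :=
    mul_nonneg θ.coe_nonneg (mul_nonneg ht measureReal_nonneg)
  linarith [h.potential_le]

theorem evacuate (hA : A.IsCompetitive r) (h : Play B A θ b Set.univ s σ) :
    ∃ τ, Play B A θ b (B.evac s)ᶜ s (σ ++ [τ]) := by
  obtain ⟨c, hcost⟩ := hA.exists_expectedCost_le
  set τ := confine (S ∩ (B.evac s)ᶜ) 0
  have hwork : ∀ x ∈ S, x ∈ (B.evac s)ᶜ → WorkLE x₀ (σ ++ [τ]) x (B.work s x) := by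
    intro x hx hxF
    simpa using (h.workLE x hx trivial).append_singleton (x := x) (τ := τ) le_rfl
      ((confine_of_mem (F := S ∩ (B.evac s)ᶜ) ⟨hx, hxF⟩ 0).trans_le zero_le)
  obtain ⟨y, hy, hyF, -⟩ := B.exists_work_le s
  have hfin := (hcost _ _ _ (hwork y hy hyF)).1
  have hmem := RandomizedOnlineAlgorithm.ae_mem_of_confine hfin
  refine ⟨τ, hwork, hmem, h.potential_append_singleton_le hfin (hmem.mono fun _ => And.left) hy
    le_rfl (by simp) ?_ (by simp)⟩
  simpa [Pi.sub_def] using (B.lipschitzOnWith_price s).weaken le_self_add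

theorem exists_hit (hA : A.IsCompetitive r) (hε : 0 ≤ ε)
    (hsep : ∀ x y : X, x ≠ y → ε ≤ θ * dist x y) (h : Play B A θ b (B.evac s)ᶜ s σ) :
    ∃ s' τ, Play B A θ b Set.univ s' (σ ++ [τ]) ∧ B.gain ≤ B.level s' - B.level s := by
  obtain ⟨c, hcost⟩ := hA.exists_expectedCost_le
  obtain ⟨l, hl, s', hgain, -, hstep, hsettle, hhit⟩ := B.exists_step s (A.prob σ)
    (fun _ _ => measureReal_nonneg) fun x _ hx =>
      RandomizedOnlineAlgorithm.prob_eq_zero h.ae_mem fun hmem => hmem.2 hx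
  rw [RandomizedOnlineAlgorithm.sum_prob_eq_one (h.ae_mem.mono fun _ => And.left)] at hstep
  set τ := confine (S : Set X) (Set.indicator {l} fun _ => ENNReal.ofReal ε)
  have hτ (x : X) (hx : x ∈ S) : τ x = ENNReal.ofReal (Set.indicator {l} (fun _ => ε) x) := by
    refine (confine_of_mem (Finset.mem_coe.2 hx) _).trans ?_
    by_cases hxl : x = l <;> simp [hxl]
  have hwork : ∀ x ∈ S, WorkLE x₀ (σ ++ [τ]) x (B.work s' x) := by
    intro x hx
    obtain ⟨y, hy, hyF, hyx⟩ := B.work_settle s x hx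
    refine ((h.workLE y hy hyF).append_singleton
      (Set.indicator_nonneg (fun _ _ => hε) x) (hτ x hx).le).mono ?_
    by_cases hxl : x = l
    · subst hxl
      simpa using (add_le_add_left hyx ε).trans hhit
    · simpa [hxl] using hyx.trans (hsettle x hx)
  have hfin := (hcost _ _ _ (hwork l hl)).1
  have hmem := RandomizedOnlineAlgorithm.ae_mem_of_confine hfin
  refine ⟨s', τ, ⟨fun x hx _ => hwork x hx, hmem.mono fun _ hx => ⟨hx, trivial⟩,
    h.potential_append_singleton_le hfin hmem hl hε (by simp [hτ l hl])
      ((B.lipschitzOnWith_price s').sub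
        (lipschitzWith_indicator_singleton hsep hε l).lipschitzOnWith) ?_⟩, hgain⟩
  linarith

theorem exists_level_ge (hA : A.IsCompetitive r) (hε : 0 ≤ ε)
    (hsep : ∀ x y : X, x ≠ y → ε ≤ θ * dist x y) (h : Play B A θ b Set.univ s σ) (a : ℝ) :
    ∃ s' σ', Play B A θ b Set.univ s' σ' ∧ a ≤ B.level s' := by
  suffices hrounds : ∀ n : ℕ, ∃ s' σ', Play B A θ b Set.univ s' σ' ∧
      B.level s + n * B.gain ≤ B.level s' by
    obtain ⟨n, hn⟩ := exists_nat_ge ((a - B.level s) / B.gain)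
    rw [div_le_iff₀ B.gain_pos] at hn
    obtain ⟨s', σ', h', hlevel⟩ := hrounds n
    exact ⟨s', σ', h', by linarith⟩
  intro n
  induction n with
  | zero => exact ⟨s, σ, h, by simp⟩
  | succ n ih =>
    obtain ⟨s₁, σ₁, h₁, hlevel⟩ := ih
    obtain ⟨τ, h₂⟩ := h₁.evacuate hA
    obtain ⟨s₂, τ', h₃, hgain⟩ := h₂.exists_hit hA hε hsep
    exact ⟨s₂, _, h₃, by push_cast; linarith⟩

end Play

theorem HasAdversary.le_mul_of_isCompetitive {X : Type u} [MetricSpace X] [Finite X] {x₀ : X}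
    {L : Finset X} {R K : ℝ} (h : HasAdversary L R K) {A : RandomizedOnlineAlgorithm.{u, v} X x₀}
    {r : ℝ≥0} (hA : A.IsCompetitive r) {θ : ℝ≥0} (hθ : 0 < θ) : R ≤ (1 + θ) * r := by
  have hsep : ∀ᶠ ε in 𝓝[>] (0 : ℝ), ∀ x y : X, x ≠ y → ε ≤ θ * dist x y := by
    simp only [eventually_all]
    exact fun x y hxy => nhdsWithin_le_nhds (Iic_mem_nhds (by have := dist_pos.2 hxy; positivity))
  obtain ⟨ε, ⟨⟨S, -, ⟨B⟩⟩, hsep⟩, hε⟩ := ((h.and hsep).and self_mem_nhdsWithin).exists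
  obtain ⟨b, s, σ, hstart⟩ := Play.exists_fresh hA B θ
  obtain ⟨c, hcost⟩ := hA.exists_expectedCost_le
  by_contra! hlt
  obtain ⟨s', σ', hplay, hlevel⟩ := hstart.exists_level_ge hA (le_of_lt hε) hsep
    (((1 + θ) * c + b + K + 1) / (R - (1 + θ) * r))
  rw [div_le_iff₀ (sub_pos.2 hlt)] at hlevel
  obtain ⟨y, hy, -, hwork⟩ := B.exists_work_le s'
  have hpaid : (A.expectedCost σ').toReal ≤ r * B.level s' + c :=
    (hcost σ' y _ (hplay.workLE y hy trivial)).2.trans (by gcongr)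
  have hprice := (abs_le.1 (RandomizedOnlineAlgorithm.abs_sum_mul_prob_le
    (hplay.ae_mem.mono fun _ => And.left) (B.abs_price_le s'))).1
  have hpaid' := mul_le_mul_of_nonneg_left hpaid (by positivity : (0 : ℝ) ≤ 1 + θ)
  linarith [hplay.potential_le]

theorem HasAdversary.le_of_isCompetitive {X : Type u} [MetricSpace X] [Finite X] {x₀ : X}
    {L : Finset X} {R K : ℝ} (h : HasAdversary L R K) {A : RandomizedOnlineAlgorithm.{u, v} X x₀}
    {r : ℝ≥0} (hA : A.IsCompetitive r) : R ≤ r := by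
  have hlim : Tendsto (fun θ : ℝ≥0 => (1 + θ : ℝ) * r) (𝓝[>] 0) (𝓝 ((1 + (0 : ℝ≥0)) * r)) :=
    (Continuous.tendsto (by fun_prop) 0).mono_left nhdsWithin_le_nhds
  simpa using ge_of_tendsto hlim
    (eventually_nhdsWithin_of_forall fun θ hθ => h.le_mul_of_isCompetitive hA hθ)

theorem log_natCast_le_two_mul_sq (n : ℕ) : Real.log n ≤ 2 * Real.log n ^ 2 := by
  obtain hn | hn := lt_or_ge n 2
  · interval_cases n <;> simp
  · have hlog : Real.log 2 ≤ Real.log n := Real.log_le_log two_pos (by exact_mod_cast hn)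
    nlinarith [Real.log_two_gt_d9]

theorem mainTheorem3_general {X : Type u} [MetricSpace X] [Fintype X] {k : ℝ} (hk1 : 1 ≤ k)
    (hk : 16 * Real.log (Fintype.card X) ≤ k) (hX : IsHST k X) {x₀ : X}
    {A : RandomizedOnlineAlgorithm.{u, v} X x₀} {r : ℝ≥0} (hA : A.IsCompetitive r) :
    Real.log (Fintype.card X) / 128 ≤ r := by
  obtain ⟨K, hadv⟩ := hX.hasAdversary hk1 hk
  exact hadv.le_of_isCompetitive hA

theorem mainTheorem3 :
    ∃ C : ℝ, 0 < C ∧ ∃ c : ℝ, 0 < c ∧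
      ∀ (X : Type u) [MetricSpace X] [Fintype X] (k : ℝ), 1 ≤ k →
        C * Real.log (Fintype.card X) ^ 2 ≤ k → IsHST k X →
          ∀ (x₀ : X) (A : RandomizedOnlineAlgorithm.{u, v} X x₀) (r : ℝ≥0),
            A.IsCompetitive r → c * Real.log (Fintype.card X) ≤ r := by
  refine ⟨32, by norm_num, 1 / 128, by norm_num, fun X _ _ k hk1 hk hX x₀ A r hA => ?_⟩
  have hlog := log_natCast_le_two_mul_sq (Fintype.card X)
  linarith [mainTheorem3_general hk1 (by linarith) hX hA]
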